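/- Setting. Let $\Gamma=\mathbb Z\mathbf r_1+\mathbb Z\mathbf r_2\subset\mathbb R^2$ with $\mathbf r_1=(\tfrac{\sqrt3}{2},\tfrac12)$, $\mathbf r_2=(\tfrac{\sqrt3}{2},-\tfrac12)$, let $\mathbf K=(0,\tfrac{4\pi}{3})$, let $R$ be the rotation of the plane by $2\pi/3$, $\omega=e^{2\pi i/3}$, and $\widetilde R f(\mathbf x)=e^{-i\mathbf K\cdot\mathbf x}e^{i\mathbf K\cdot R\mathbf x}f(R\mathbf x)$. A real function on $\mathbb R^2$ has honeycomb symmetry if it is $\Gamma$-periodic, even and $R$-invariant. All functions below are $\Gamma$-periodic; $L^2$ and $H^2$ are the spaces over $\mathbb R^2/\Gamma$, with inner product $\langle f,g\rangle=\int_{\mathbb R^2/\Gamma}\overline f g\,d^2\mathbf x$. Let $V_{NL}(\mathbf x,s)=V_L(\mathbf x)+v(\mathbf x,s)$ be real-valued, $C^\infty$ in $(\mathbf x,s)\in\mathbb R^2\times[0,\infty)$ and $\Gamma$-periodic in $\mathbf x$, where $V_L$ has honeycomb symmetry and $v(\mathbf x,s)=K(\mathbf x)s+O(s^2)$ as $s\to0^+$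 with a nonzero function $K$ of honeycomb symmetry. Let $E_0$ be the first eigenvalue of $-(\nabla+i\mathbf K)^2+V_L$ on $\mathbb R^2/\Gamma$, and suppose that its eigenspace is spanned by $\phi_0^a,\phi_0^b$ with $\|\phi_0^a\|_{L^2}=\|\phi_0^b\|_{L^2}=1$, $\widetilde R\phi_0^a=\omega\phi_0^a$, $\widetilde R\phi_0^b=\overline\omega\phi_0^b$, $\phi_0^a(\mathbf x)=\overline{\phi_0^b(-\mathbf x)}$. Suppose $\int_{\mathbb R^2/\Gamma}K\left(|\phi_0^a|^4-2|\phi_0^b|^2|\phi_0^a|^2\right)d^2\mathbf x\neq0$. Let $\Sigma=\{(a,b)\in\mathbb C^2:|a|^2+|b|^2=1\}$ and $\Sigma_q=\Sigma/\!\sim$, where $(a,b)\sim(c,d)$ iff $ad-bc=0$. For $C,\varepsilon,\eta>0$ and $(a,b)\in\Sigma$, consider the pairs $(\phi,E)\in H^2\times\mathbb C$ such that (i) $-(\nabla+i\mathbf K)^2\phi+V_{NL}(\mathbf x,|\phi|^2)\phi=E\phi$; (ii) $\phi=\eta(a\phi_0^a+b\phi_0^b)+\widetilde\phi$ with $\langle\phi_0^a,\widetilde\phi\rangle=\langle\phi_0^b,\widetilde\phi\rangle=0$;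 (iii) $\|\phi\|_{L^2}\le\varepsilon$, $\|\phi\|_{H^2}\le C\varepsilon$ and $|E-E_0|\le\varepsilon$. Let $\Sigma_q^a(\varepsilon,\eta)\subset\Sigma_q$ be the set of classes of the pairs $(a,b)$ for which at least one such $(\phi,E)$ exists (the allowed pairs with amplitude $\eta$). Proposition (Uniqueness). For every $C>0$ there is $\varepsilon_0>0$ such that for all $0<\varepsilon<\varepsilon_0$, all $\eta>0$ and every $(a,b)\in\Sigma$ whose class lies in $\Sigma_q^a(\varepsilon,\eta)$, there is exactly one pair $(\phi,E)\in H^2\times\mathbb C$ that satisfies (i), (ii) and (iii). -/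

import Mathlib

open MeasureTheory Filter Topology Asymptotics
open scoped ContDiff ComplexConjugate

noncomputable section

namespace HoneycombNLS

/-! ### The honeycomb lattice and its torus -/

/-- The Euclidean plane. -/
abbrev Plane : Type := EuclideanSpace ℝ (Fin 2)

/-- First primitive vector of the lattice `Γ`. -/
def r₁ : Plane := !₂[Real.sqrt 3 / 2, 1 / 2]

/-- Second primitive vector of the lattice `Γ`. -/
def r₂ : Plane := !₂[Real.sqrt 3 / 2, -(1 / 2)]

/-- The momentum `K`, a corner of the Brillouin zone. -/
def momK : Plane := !₂[0, 4 * Real.pi / 3]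

/-- Rotation of the plane by `2π/3`. -/
def rot (x : Plane) : Plane :=
  !₂[-(1 / 2) * x 0 - Real.sqrt 3 / 2 * x 1, Real.sqrt 3 / 2 * x 0 - 1 / 2 * x 1]

/-- `Γ`-periodicity, where `Γ = ℤ r₁ + ℤ r₂`. -/
def IsPeriodic {α : Type} (f : Plane → α) : Prop :=
  ∀ x, f (x + r₁) = f x ∧ f (x + r₂) = f x

/-- Honeycomb symmetry: `Γ`-periodic, even, and invariant under rotation by `2π/3`. -/
structure IsHoneycomb (V : Plane → ℝ) : Prop where
  periodic : IsPeriodic V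
  even : ∀ x, V (-x) = V x
  rotation : ∀ x, V (rot x) = V x

/-- A fundamental cell of `Γ`. -/
def cell : Set Plane :=
  {x | ∃ s ∈ Set.Ico (0 : ℝ) 1, ∃ t ∈ Set.Ico (0 : ℝ) 1, x = s • r₁ + t • r₂}

/-- Lebesgue measure on the fundamental cell. Integrating a `Γ`-periodic function against it is
integrating over the torus `ℝ² / Γ`; functions on the torus are `Γ`-periodic functions on the
plane, identified when they agree almost everywhere for this measure. -/
def torus : Measure Plane := volume.restrict cell

/-! ### Function spaces on the torus -/

/-- `L²(ℝ² / Γ)`. -/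
def MemL2 (f : Plane → ℂ) : Prop := IsPeriodic f ∧ MemLp f 2 torus

/-- The `L²` inner product, antilinear in the first argument. -/
def inner2 (f g : Plane → ℂ) : ℂ := ∫ x, conj (f x) * g x ∂torus

/-- The `L²` norm. -/
def l2Norm (f : Plane → ℂ) : ℝ := Real.sqrt (∫ x, ‖f x‖ ^ 2 ∂torus)

/-- `g ∈ L²(ℝ² / Γ)` is the weak partial derivative `∂ᵢ f` on the torus. -/
def HasWeakPartial (i : Fin 2) (f g : Plane → ℂ) : Prop :=
  MemL2 g ∧ ∀ q : Plane → ℂ, ContDiff ℝ ∞ q → IsPeriodic q →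
    ∫ x, f x * fderiv ℝ q x (EuclideanSpace.single i 1) ∂torus = -∫ x, g x * q x ∂torus

open Classical in
/-- The weak partial derivative `∂ᵢ f` (determined almost everywhere), and `0` if there is
none in `L²`. -/
def weakPartial (i : Fin 2) (f : Plane → ℂ) : Plane → ℂ :=
  if h : ∃ g, HasWeakPartial i f g then h.choose else 0

/-- The Sobolev space `H²(ℝ² / Γ)`: all weak derivatives of order at most two are in `L²`. -/
structure MemH2 (f : Plane → ℂ) : Prop where
  memL2 : MemL2 f
  first : ∀ i, ∃ g, HasWeakPartial i f g
  second : ∀ i j, ∃ g, HasWeakPartial j (weakPartial i f) g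

/-- The norm of `H²(ℝ² / Γ)`. -/
def h2Norm (f : Plane → ℂ) : ℝ :=
  Real.sqrt (l2Norm f ^ 2 + ∑ i, l2Norm (weakPartial i f) ^ 2
    + ∑ i, ∑ j, l2Norm (weakPartial j (weakPartial i f)) ^ 2)

/-! ### Hamiltonians at the momentum `K` -/

/-- `(∇ + iK)² f = ∑ⱼ (∂ⱼ∂ⱼ f + 2 i Kⱼ ∂ⱼ f - Kⱼ² f)`. -/
def laplacianK (f : Plane → ℂ) (x : Plane) : ℂ :=
  ∑ j, (weakPartial j (weakPartial j f) x + 2 * Complex.I * (momK j : ℂ) * weakPartial j f x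
    - (momK j : ℂ) ^ 2 * f x)

/-- `(-(∇ + iK)² + W) f` for a real potential `W`. -/
def hamiltonian (W : Plane → ℝ) (f : Plane → ℂ) (x : Plane) : ℂ :=
  -laplacianK f x + (W x : ℂ) * f x

/-- The nonlinear Hamiltonian `H(K)` with `V_NL(x, s) = V_L(x) + v(x, s)`, applied to `f`
itself: `-(∇ + iK)² f + V_NL(x, |f|²) f`. -/
def nonlinearHamiltonian (VL : Plane → ℝ) (v : Plane → ℝ → ℝ) (f : Plane → ℂ) : Plane → ℂ :=
  hamiltonian (fun x => VL x + v x (‖f x‖ ^ 2)) f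

/-- `f ∈ H²` satisfies the linear equation `(-(∇ + iK)² + V_L) f = E f` on the torus. -/
def SolvesLinear (VL : Plane → ℝ) (E : ℝ) (f : Plane → ℂ) : Prop :=
  MemH2 f ∧ ∀ᵐ x ∂torus, hamiltonian VL f x = (E : ℂ) * f x

/-- `E` is an eigenvalue of `-(∇ + iK)² + V_L` on the torus. -/
def IsLinearEigenvalue (VL : Plane → ℝ) (E : ℝ) : Prop :=
  ∃ f, SolvesLinear VL E f ∧ ¬ f =ᵐ[torus] 0

/-- `ω = exp(2πi/3)`. -/
def omega : ℂ := Complex.exp (2 * Real.pi * Complex.I / 3)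

/-- The transformed rotation `f ↦ exp(-iK·x) [exp(iK·(·)) f](R x)`. -/
def rotK (f : Plane → ℂ) (x : Plane) : ℂ :=
  Complex.exp (-(Complex.I * (inner ℝ momK x : ℝ))) *
    (Complex.exp (Complex.I * (inner ℝ momK (rot x) : ℝ)) * f (rot x))

/-- Membership in the space `L²_{K,σ}` of `σ`-eigenfunctions of the transformed rotation. -/
def InRotSpace (σ : ℂ) (f : Plane → ℂ) : Prop :=
  MemL2 f ∧ ∀ᵐ x ∂torus, rotK f x = σ * f x

/-- `E₀` is the first eigenvalue of the linear Hamiltonian at `K`, its eigenspace is the span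
of the normalized functions `φa ∈ L²_{K,ω}` and `φb ∈ L²_{K,ω̄}`, and
`φa(x) = conj (φb(-x))`. -/
structure IsGroundPair (VL : Plane → ℝ) (E₀ : ℝ) (φa φb : Plane → ℂ) : Prop where
  first_eigenvalue : IsLeast {E | IsLinearEigenvalue VL E} E₀
  solves_a : SolvesLinear VL E₀ φa
  solves_b : SolvesLinear VL E₀ φb
  rot_a : InRotSpace omega φa
  rot_b : InRotSpace (conj omega) φb
  norm_a : l2Norm φa = 1
  norm_b : l2Norm φb = 1
  conj_inv : ∀ᵐ x ∂torus, φa x = conj (φb (-x))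
  spans : ∀ f, SolvesLinear VL E₀ f → ∃ α β : ℂ, f =ᵐ[torus] fun x => α * φa x + β * φb x

/-! ### The allowed parameter space -/

/-- The full parameter space `Σ = {(a, b) : |a|² + |b|² = 1}`. -/
def Param : Type := {p : ℂ × ℂ // ‖p.1‖ ^ 2 + ‖p.2‖ ^ 2 = 1}

/-- The equivalence `(a, b) ~ (c, d) ↔ ad - bc = 0` on `Σ`. -/
instance paramSetoid : Setoid Param where
  r p q := p.1.1 * q.1.2 - p.1.2 * q.1.1 = 0
  iseqv := by
    refine ⟨fun p => by ring, fun {p q} h => by linear_combination -h, fun {p q r} h h' => ?_⟩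
    by_cases hc : q.1.1 = 0
    · have hd : q.1.2 ≠ 0 := by
        intro hd
        have := q.2
        simp [hc, hd] at this
      apply mul_left_cancel₀ hd
      linear_combination r.1.2 * h + p.1.2 * h'
    · apply mul_left_cancel₀ hc
      linear_combination r.1.1 * h + p.1.1 * h'

/-- The quotient `Σ_q = Σ / ~`. -/
def ParamQ : Type := Quotient paramSetoid

/-- `f ∈ H²` is an eigenfunction of the nonlinear Hamiltonian `H(K)` with eigenvalue `E`, its
component in the linear ground space is `η (a φa + b φb)`, that is,
`f = η (a φa + b φb) + f̃` with `f̃` orthogonal to `φa` and `φb`, and the smallness conditions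
`‖f‖_{L²} ≤ ε`, `‖f‖_{H²} ≤ C ε`, `|E - E₀| ≤ ε` hold. -/
structure IsSmallEigenfunction (VL : Plane → ℝ) (v : Plane → ℝ → ℝ) (E₀ : ℝ)
    (φa φb : Plane → ℂ) (C ε η : ℝ) (p : Param) (f : Plane → ℂ) (E : ℂ) : Prop where
  memH2 : MemH2 f
  eigen : ∀ᵐ x ∂torus, nonlinearHamiltonian VL v f x = E * f x
  proj_a : inner2 φa f = (η : ℂ) * p.1.1
  proj_b : inner2 φb f = (η : ℂ) * p.1.2
  l2_small : l2Norm f ≤ ε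
  h2_small : h2Norm f ≤ C * ε
  near : ‖E - (E₀ : ℂ)‖ ≤ ε

/-- The allowed parameter space at amplitude `η`: the classes in `Σ_q` of the pairs for which
there is at least one small eigenfunction. -/
def allowed (VL : Plane → ℝ) (v : Plane → ℝ → ℝ) (E₀ : ℝ)
    (φa φb : Plane → ℂ) (C ε η : ℝ) : Set ParamQ :=
  {c | ∃ p : Param, (Quotient.mk paramSetoid p : ParamQ) = c ∧
    ∃ f E, IsSmallEigenfunction VL v E₀ φa φb C ε η p f E}

end HoneycombNLS

end

open MeasureTheory Filter Topology Asymptotics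
open scoped ContDiff ComplexConjugate

noncomputable section

namespace HoneycombNLS

section FourierTransfer

/-! ### Lattice coordinates and the standard torus -/

-- Let `f`, `f'` be two small solutions with eigenvalues `E`, `E'` and the same component η(a φa + b
-- φb), put ψ = f - f', and let N, N' be their nonlinear terms. Then ψ is orthogonal to the ground
-- space and (H - E₀)ψ = (E - E₀)ψ + (E - E')f' - (N - N'), where H is the linear Hamiltonian. The
-- claim is that this forces ‖ψ‖ ≤ O(ε)‖ψ‖ in L², hence ψ = 0.
--
-- Three facts carry the argument. The Sobolev embedding `exists_sobolev_const` makes solutions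
-- pointwise O(ε); with the Lipschitz bound `exists_lipschitz_const` and v(x,0) = 0 this gives ‖N -
-- N'‖ ≤ Bε²‖ψ‖ and ‖N'‖ ≤ Bε²‖f'‖. The gap estimate `exists_gap_const` bounds a function by H - E₀
-- applied to it and its two ground components. Symmetry of H allows testing the equation with φa
-- and φb (`norm_shift_mul_le`), which yields |E - E'| η ≤ 2‖N - N'‖.
--
-- The delicate term is (E - E')f', since η may be arbitrarily small and the shift bound loses a
-- factor 1/η. The gap estimate applied to f' itself shows ‖f'‖ ≤ 4Gη, so the factor cancels and |E
-- - E'|‖f'‖ ≤ 8G‖N - N'‖, uniformly in η. Everything is then absorbed in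
-- `IsSmallEigenfunction.unique`. Existence for each representative of an allowed class follows from
-- invariance under a constant phase.
--
-- The analysis on the torus is done on Fourier coefficients: a weak derivative is multiplication by
-- iξ, and H² is a weighted ℓ² space. The embedding follows from Cauchy–Schwarz, the gap from a
-- compactness argument on the coefficients.

local instance : MeasureSpace UnitAddCircle := ⟨AddCircle.haarAddCircle⟩

-- Total mass one on the circle is the normalization under which the monomials
-- `UnitAddTorus.mFourier` are orthonormal.
local instance : Measure.IsAddHaarMeasure (volume : Measure UnitAddCircle) :=
  inferInstanceAs (Measure.IsAddHaarMeasure AddCircle.haarAddCircle)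

local instance : IsProbabilityMeasure (volume : Measure UnitAddCircle) :=
  inferInstanceAs (IsProbabilityMeasure AddCircle.haarAddCircle)

/-- The torus `ℝ² / ℤ²`. -/
abbrev Torus2 : Type := UnitAddTorus (Fin 2)

/-- The coordinates of a point of the plane with respect to `r₁`, `r₂`. -/
def coords (x : Plane) : Fin 2 → ℝ := ![x 0 / Real.sqrt 3 + x 1, x 0 / Real.sqrt 3 - x 1]

/-- The linear equivalence `(s, t) ↦ s r₁ + t r₂`. -/
def latticeEquivₗ : (Fin 2 → ℝ) ≃ₗ[ℝ] Plane where
  toFun u := u 0 • r₁ + u 1 • r₂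
  map_add' u w := by simp only [Pi.add_apply, add_smul]; abel
  map_smul' c u := by simp [mul_smul]
  invFun := coords
  left_inv u := by
    have h : Real.sqrt 3 ≠ 0 := by positivity
    ext i
    fin_cases i <;> simp [coords, r₁, r₂] <;> field_simp <;> ring
  right_inv x := by
    have h : Real.sqrt 3 ≠ 0 := by positivity
    ext i
    fin_cases i <;> simp [coords, r₁, r₂] <;> field_simp <;> ring

/-- The continuous linear equivalence `(s, t) ↦ s r₁ + t r₂`. -/
def latticeEquiv : (Fin 2 → ℝ) ≃L[ℝ] Plane := latticeEquivₗ.toContinuousLinearEquiv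

lemma latticeEquiv_apply (u : Fin 2 → ℝ) : latticeEquiv u = u 0 • r₁ + u 1 • r₂ := rfl

lemma latticeEquiv_symm_apply (x : Plane) : latticeEquiv.symm x = coords x := rfl

lemma coords_latticeEquiv (u : Fin 2 → ℝ) : coords (latticeEquiv u) = u :=
  latticeEquiv.symm_apply_apply u

instance : (Measure.map latticeEquiv (volume : Measure (Fin 2 → ℝ))).IsAddHaarMeasure :=
  latticeEquiv.isAddHaarMeasure_map _

/-- The area of the fundamental cell. -/
def cellVol : NNReal :=
  Measure.addHaarScalarFactor (volume : Measure Plane) (Measure.map latticeEquiv volume)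

/-- Uniqueness of Haar measure. The numerical area of the cell plays no role later; only its
positivity does. -/
lemma volume_eq_smul_map :
    (volume : Measure Plane) = cellVol • Measure.map latticeEquiv volume :=
  Measure.isAddLeftInvariant_eq_smul _ _

lemma cellVol_pos : 0 < cellVol :=
  Measure.addHaarScalarFactor_pos_of_isAddHaarMeasure _ _

/-- The half-open unit square. -/
def unitBox : Set (Fin 2 → ℝ) := {x | ∀ i, x i ∈ Set.Ioc (0 : ℝ) (0 + 1)}

lemma cell_eq_image : cell = latticeEquiv '' (Set.univ.pi fun _ => Set.Ico (0 : ℝ) 1) := by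
  ext x
  constructor
  · rintro ⟨s, hs, t, ht, rfl⟩
    refine ⟨![s, t], ?_, by simp [latticeEquiv_apply]⟩
    intro i _
    fin_cases i <;> simpa
  · rintro ⟨u, hu, rfl⟩
    exact ⟨u 0, hu 0 trivial, u 1, hu 1 trivial, latticeEquiv_apply u⟩

lemma measurableSet_cell : MeasurableSet cell := by
  rw [cell_eq_image]
  exact latticeEquiv.toHomeomorph.measurableEmbedding.measurableSet_image.2
    (MeasurableSet.univ_pi fun _ => measurableSet_Ico)

/-- The cell is closed on the left, while the fundamental domain of `measurableEquivPiIoc` is closed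
on the right; the two differ by boundary faces of measure zero. -/
lemma ico_ae_eq_unitBox :
    (Set.univ.pi fun _ => Set.Ico (0 : ℝ) 1 : Set (Fin 2 → ℝ)) =ᵐ[volume] unitBox := by
  have h : unitBox = Set.univ.pi fun _ => Set.Ioc (0 : ℝ) 1 := by
    ext x; simp [unitBox]
  rw [h]
  exact (Measure.univ_pi_Ico_ae_eq_Icc (f := fun _ : Fin 2 => (0 : ℝ)) (g := fun _ => 1)).trans
    (Measure.univ_pi_Ioc_ae_eq_Icc (f := fun _ : Fin 2 => (0 : ℝ)) (g := fun _ => 1)).symm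

lemma torus_eq_map : torus = cellVol • Measure.map latticeEquiv (volume.restrict unitBox) := by
  have he : MeasurableEmbedding latticeEquiv := latticeEquiv.toHomeomorph.measurableEmbedding
  rw [torus, volume_eq_smul_map, Measure.restrict_smul, he.restrict_map, cell_eq_image,
    Set.preimage_image_eq _ latticeEquiv.injective, Measure.restrict_congr_set ico_ae_eq_unitBox]

/-- The section of the covering `ℝ² → ℝ² / Γ`, read in lattice coordinates. -/
def section2 (u : Torus2) : Plane :=
  latticeEquiv (UnitAddTorus.measurableEquivPiIoc (fun _ : Fin 2 => (0 : ℝ)) u).1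

/-- The covering `ℝ² → ℝ² / Γ`, read in lattice coordinates. -/
def proj2 (x : Plane) : Torus2 := fun i => ((coords x i : ℝ) : UnitAddCircle)

lemma proj2_section2 (u : Torus2) : proj2 (section2 u) = u := by
  have := (UnitAddTorus.measurableEquivPiIoc (fun _ : Fin 2 => (0 : ℝ))).symm_apply_apply u
  rw [UnitAddTorus.coe_symm_measurableEquivPiIoc_apply] at this
  refine Eq.trans ?_ this
  funext i
  simp only [proj2, section2, coords_latticeEquiv]

lemma measurableSet_unitBox : MeasurableSet unitBox :=
  MeasurableSet.univ_pi' fun _ => measurableSet_Ioc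

lemma measurableEmbedding_section2 : MeasurableEmbedding section2 :=
  (latticeEquiv.toHomeomorph.measurableEmbedding.comp
    (MeasurableEmbedding.subtype_coe measurableSet_unitBox)).comp
      (UnitAddTorus.measurableEquivPiIoc (fun _ : Fin 2 => (0 : ℝ))).measurableEmbedding

lemma measurePreserving_section2 :
    MeasurePreserving section2 (cellVol • (volume : Measure Torus2)) torus := by
  refine ⟨measurableEmbedding_section2.measurable, ?_⟩
  have h1 := (UnitAddTorus.measurePreserving_equivPiIoc (fun _ : Fin 2 => (0 : ℝ))).map_eq
  have h2 : Measure.map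
      (Subtype.val : {x : Fin 2 → ℝ // ∀ i, x i ∈ Set.Ioc (0 : ℝ) (0 + 1)} → _)
      (Measure.comap Subtype.val volume) = volume.restrict unitBox := map_comap_subtype_coe measurableSet_unitBox volume
  rw [Measure.map_smul, torus_eq_map]
  congr 1
  rw [← h2, ← h1, Measure.map_map measurable_subtype_coe (MeasurableEquiv.measurable _),
    Measure.map_map latticeEquiv.continuous.measurable
      (measurable_subtype_coe.comp (MeasurableEquiv.measurable _))]
  rfl

instance : IsFiniteMeasure torus := by
  rw [← measurePreserving_section2.map_eq]
  infer_instance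

/-! ### Exponentials of the dual lattice -/

/-- The dual lattice vector of index `k`. -/
def freq (k : Fin 2 → ℤ) (i : Fin 2) : ℝ :=
  2 * Real.pi * (![((k 0 : ℝ) + k 1) / Real.sqrt 3, (k 0 : ℝ) - k 1] : Fin 2 → ℝ) i

/-- The normalizing constant of the exponentials. -/
def expoConst : ℝ := (Real.sqrt cellVol)⁻¹

lemma expoConst_pos : 0 < expoConst :=
  inv_pos.2 (Real.sqrt_pos.2 (by exact_mod_cast cellVol_pos))

lemma expoConst_sq : expoConst ^ 2 * cellVol = 1 := by
  have h : (0 : ℝ) < cellVol := by exact_mod_cast cellVol_pos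
  rw [expoConst, inv_pow, Real.sq_sqrt h.le, inv_mul_cancel₀ h.ne']

/-- The normalized exponential of index `k` on the torus. -/
def expo (k : Fin 2 → ℤ) (x : Plane) : ℂ :=
  expoConst * Complex.exp (Complex.I * ((freq k 0 * x 0 + freq k 1 * x 1 : ℝ) : ℂ))

/-- `freq` is dual to `coords`: the phase ξ_k · x equals 2π(k₀ s + k₁ t) for x = s r₁ + t r₂. -/
lemma expo_eq (k : Fin 2 → ℤ) (x : Plane) :
    expo k x = expoConst * UnitAddTorus.mFourier k (proj2 x) := by
  simp only [expo, UnitAddTorus.mFourier, ContinuousMap.coe_mk, Fin.prod_univ_two, proj2,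
    fourier_coe_apply, ← Complex.exp_add]
  congr 2
  simp [freq, coords]
  ring

lemma coords_add_r₁ (x : Plane) : coords (x + r₁) = coords x + ![1, 0] := by
  rw [← latticeEquiv_symm_apply, map_add, latticeEquiv_symm_apply]
  congr 1
  rw [ContinuousLinearEquiv.symm_apply_eq]
  simp [latticeEquiv_apply]

lemma coords_add_r₂ (x : Plane) : coords (x + r₂) = coords x + ![0, 1] := by
  rw [← latticeEquiv_symm_apply, map_add, latticeEquiv_symm_apply]
  congr 1
  rw [ContinuousLinearEquiv.symm_apply_eq]
  simp [latticeEquiv_apply]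

lemma isPeriodic_proj2 : IsPeriodic proj2 := by
  refine fun x => ⟨?_, ?_⟩ <;> funext i
  · simp only [proj2, coords_add_r₁]
    fin_cases i <;> simp
  · simp only [proj2, coords_add_r₂]
    fin_cases i <;> simp

lemma isPeriodic_comp_proj2 {α : Type} (F : Torus2 → α) : IsPeriodic fun x => F (proj2 x) :=
  fun x => ⟨congrArg F (isPeriodic_proj2 x).1, congrArg F (isPeriodic_proj2 x).2⟩

lemma isPeriodic_expo (k : Fin 2 → ℤ) : IsPeriodic (expo k) := by
  have := isPeriodic_comp_proj2 fun u => (expoConst : ℂ) * UnitAddTorus.mFourier k u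
  simpa only [← expo_eq] using this

lemma norm_expo (k : Fin 2 → ℤ) (x : Plane) : ‖expo k x‖ = expoConst := by
  rw [expo, norm_mul, mul_comm Complex.I, Complex.norm_exp_ofReal_mul_I, mul_one,
    Complex.norm_real, Real.norm_of_nonneg expoConst_pos.le]

lemma conj_expo (k : Fin 2 → ℤ) (x : Plane) : conj (expo k x) = expo (-k) x := by
  rw [expo_eq, expo_eq, map_mul, Complex.conj_ofReal, UnitAddTorus.mFourier_neg]

lemma contDiff_expo (k : Fin 2 → ℤ) : ContDiff ℝ ∞ (expo k) := by
  have h : ∀ i : Fin 2, ContDiff ℝ ∞ fun x : Plane => x i := fun i =>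
    (EuclideanSpace.proj (𝕜 := ℝ) i).contDiff
  refine contDiff_const.mul (Complex.contDiff_exp.comp ?_)
  exact contDiff_const.mul (Complex.ofRealCLM.contDiff.comp
    ((contDiff_const.mul (h 0)).add (contDiff_const.mul (h 1))))

lemma fderiv_expo (k : Fin 2 → ℤ) (x : Plane) (i : Fin 2) :
    fderiv ℝ (expo k) x (EuclideanSpace.single i 1) = Complex.I * freq k i * expo k x := by
  have h : ∀ i : Fin 2, HasFDerivAt (fun x : Plane => x i)
      (EuclideanSpace.proj (𝕜 := ℝ) i : Plane →L[ℝ] ℝ) x := fun i =>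
    (EuclideanSpace.proj (𝕜 := ℝ) i).hasFDerivAt
  have h1 := ((h 0).const_mul (freq k 0)).add ((h 1).const_mul (freq k 1))
  have h2 := Complex.ofRealCLM.hasFDerivAt.comp x h1
  have h3 := ((h2.const_mul Complex.I).cexp).const_mul (expoConst : ℂ)
  have h4 : fderiv ℝ (expo k) x = _ := h3.fderiv
  rw [h4]
  fin_cases i <;> simp [expo] <;> ring

/-! ### Fourier coefficients, Parseval and Riesz–Fischer -/

/-- The Fourier coefficient of index `k`. -/
def coef (f : Plane → ℂ) (k : Fin 2 → ℤ) : ℂ := inner2 (expo k) f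

lemma integral_torus (f : Plane → ℂ) :
    ∫ x, f x ∂torus = cellVol * ∫ u : Torus2, f (section2 u) := by
  rw [← measurePreserving_section2.integral_comp measurableEmbedding_section2,
    integral_smul_nnreal_measure]
  simp [NNReal.smul_def]

lemma coef_eq_mFourierCoeff (f : Plane → ℂ) (k : Fin 2 → ℤ) :
    coef f k = cellVol * expoConst * UnitAddTorus.mFourierCoeff (f ∘ section2) k := by
  rw [coef, inner2, integral_torus, UnitAddTorus.mFourierCoeff, mul_assoc]
  congr 1
  rw [← integral_const_mul]
  congr 1
  funext u
  rw [conj_expo, expo_eq, proj2_section2]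
  simp [mul_assoc]

lemma memLp_comp_section2 {f : Plane → ℂ} (hf : MemLp f 2 torus) :
    MemLp (f ∘ section2) 2 (volume : Measure Torus2) := by
  have h := hf.comp_measurePreserving measurePreserving_section2
  have h' : MemLp (f ∘ section2) 2 (cellVol⁻¹ • cellVol • (volume : Measure Torus2)) :=
    h.smul_measure (c := ((cellVol⁻¹ : NNReal) : ENNReal)) ENNReal.coe_ne_top
  rwa [smul_smul, inv_mul_cancel₀ cellVol_pos.ne', one_smul] at h'

lemma mFourierCoeff_congr_ae {F G : Torus2 → ℂ} (h : F =ᵐ[volume] G) (k : Fin 2 → ℤ) :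
    UnitAddTorus.mFourierCoeff F k = UnitAddTorus.mFourierCoeff G k :=
  integral_congr_ae (by filter_upwards [h] with u hu; rw [hu])

/-- **Parseval's identity** on `ℝ² / Γ`. -/
theorem hasSum_conj_coef_mul_coef {f g : Plane → ℂ} (hf : MemL2 f) (hg : MemL2 g) :
    HasSum (fun k => conj (coef f k) * coef g k) (inner2 f g) := by
  have hf' := memLp_comp_section2 hf.2
  have hg' := memLp_comp_section2 hg.2
  have h := (UnitAddTorus.hasSum_prod_mFourierCoeff hf'.toLp hg'.toLp).mul_left (cellVol : ℂ)
  convert! h using 1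
  · funext k
    rw [coef_eq_mFourierCoeff, coef_eq_mFourierCoeff, mFourierCoeff_congr_ae hf'.coeFn_toLp,
      mFourierCoeff_congr_ae hg'.coeFn_toLp]
    have := congrArg (fun r : ℝ => (r : ℂ)) expoConst_sq
    push_cast at this
    simp only [map_mul, Complex.conj_ofReal]
    linear_combination (cellVol : ℂ) * (conj (UnitAddTorus.mFourierCoeff (f ∘ section2) k) *
      UnitAddTorus.mFourierCoeff (g ∘ section2) k) * this
  · rw [inner2, integral_torus]
    congr 1
    refine integral_congr_ae ?_
    filter_upwards [hf'.coeFn_toLp, hg'.coeFn_toLp] with u hu hu'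
    rw [hu, hu']; rfl

/-- **Riesz–Fischer** on `ℝ² / Γ`. -/
theorem exists_memL2_coef_eq {a : (Fin 2 → ℤ) → ℂ} (ha : Summable fun k => ‖a k‖ ^ 2) :
    ∃ f, MemL2 f ∧ ∀ k, coef f k = a k := by
  -- The factor `expoConst` compensates `cellVol * expoConst` in `coef_eq_mFourierCoeff`, by
  -- `expoConst_sq`.
  have hA : Memℓp (fun k => (expoConst : ℂ) * a k) 2 := by
    refine memℓp_gen ?_
    simp only [norm_mul, mul_pow, ENNReal.toReal_ofNat, Real.rpow_ofNat]
    exact ha.mul_left _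
  set F := UnitAddTorus.mFourierBasis.repr.symm ⟨_, hA⟩ with hF
  have hFc : ∀ k, UnitAddTorus.mFourierCoeff F k = expoConst * a k := fun k => by
    rw [← UnitAddTorus.mFourierBasis_repr, hF, LinearIsometryEquiv.apply_symm_apply]
  have hcomp : (fun x => F (proj2 x)) ∘ section2 = F := by
    funext u; simp [proj2_section2]
  refine ⟨fun x => F (proj2 x), ⟨isPeriodic_comp_proj2 _, ?_⟩, fun k => ?_⟩
  · rw [← measurePreserving_section2.map_eq, measurableEmbedding_section2.memLp_map_measure_iff,
      hcomp]
    exact (Lp.memLp F).smul_measure (c := (cellVol : ENNReal)) ENNReal.coe_ne_top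
  · rw [coef_eq_mFourierCoeff, hcomp, hFc]
    have := congrArg (fun r : ℝ => (r : ℂ)) expoConst_sq
    push_cast at this
    linear_combination a k * this

lemma coef_expo (j k : Fin 2 → ℤ) : coef (expo j) k = if j = k then 1 else 0 := by
  have h : expo j ∘ section2 = fun u => (expoConst : ℂ) * UnitAddTorus.mFourier j u := by
    funext u; simp [expo_eq, proj2_section2]
  have h2 : UnitAddTorus.mFourierCoeff (fun u : Torus2 => UnitAddTorus.mFourier j u) k =
      if j = k then 1 else 0 := by
    have h3 : UnitAddTorus.mFourierCoeff (UnitAddTorus.mFourierLp 2 j : Torus2 → ℂ) k =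
        if j = k then 1 else 0 := by
      rw [← UnitAddTorus.mFourierBasis_repr, ← UnitAddTorus.coe_mFourierBasis,
        HilbertBasis.repr_self, lp.single_apply, Pi.single_apply]
      simp only [eq_comm]
    rw [← h3]
    exact mFourierCoeff_congr_ae (UnitAddTorus.coeFn_mFourierLp 2 j).symm k
  rw [coef_eq_mFourierCoeff, h]
  have h4 : UnitAddTorus.mFourierCoeff (fun u => (expoConst : ℂ) * UnitAddTorus.mFourier j u) k =
      expoConst * UnitAddTorus.mFourierCoeff (fun u => UnitAddTorus.mFourier j u) k := by
    simp only [UnitAddTorus.mFourierCoeff]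
    rw [← integral_const_mul]
    congr 1; funext u; simp only [smul_eq_mul]; ring
  rw [h4, h2]
  have := congrArg (fun r : ℝ => (r : ℂ)) expoConst_sq
  push_cast at this
  linear_combination (if j = k then (1 : ℂ) else 0) * this

end FourierTransfer

/-! ### Integration by parts on the torus -/

/-- Opposite faces of the unit square are lattice translates of each other; this cancels the
boundary terms in the divergence theorem. -/
lemma latticeEquiv_insertNth_one (i : Fin 2) (y : Fin 1 → ℝ) {α : Type} {q : Plane → α}
    (hq : IsPeriodic q) :
    q (latticeEquiv (i.insertNth (1 : ℝ) y)) = q (latticeEquiv (i.insertNth (0 : ℝ) y)) := by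
  have h : ∀ z : Fin 2 → ℝ, q (latticeEquiv (z + ![1, 0])) = q (latticeEquiv z) ∧
      q (latticeEquiv (z + ![0, 1])) = q (latticeEquiv z) := fun z => by
    have h1 : latticeEquiv ![1, 0] = r₁ := by simp [latticeEquiv_apply]
    have h2 : latticeEquiv ![0, 1] = r₂ := by simp [latticeEquiv_apply]
    rw [map_add, map_add, h1, h2]
    exact hq _
  have e0 : ∀ c : ℝ, ((0 : Fin 2).insertNth c y : Fin 2 → ℝ) = ![c, y 0] := fun c => by
    ext j; fin_cases j <;> rfl
  have e1 : ∀ c : ℝ, ((1 : Fin 2).insertNth c y : Fin 2 → ℝ) = ![y 0, c] := fun c => by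
    ext j; fin_cases j <;> rfl
  fin_cases i
  · have := (h ((0 : Fin 2).insertNth (0 : ℝ) y)).1
    simp only [e0] at this
    simpa [e0] using this
  · have := (h ((1 : Fin 2).insertNth (0 : ℝ) y)).2
    simp only [e1] at this
    simpa [e1] using this

/-- In lattice coordinates the derivative along the image of `w` is the divergence of the field with
components `w i • q`, whose flux through opposite faces cancels. -/
theorem integral_fderiv_eq_zero {q : Plane → ℂ} (hq : ContDiff ℝ ∞ q) (hper : IsPeriodic q)
    (v : Plane) : ∫ x, fderiv ℝ q x v ∂torus = 0 := by
  obtain ⟨w, rfl⟩ := latticeEquiv.surjective v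
  have hd : Differentiable ℝ q := hq.differentiable (by simp)
  have hfd : Continuous (fderiv ℝ q) := hq.continuous_fderiv (by simp)
  have hL : MeasurableEmbedding latticeEquiv := latticeEquiv.toHomeomorph.measurableEmbedding
  rw [torus_eq_map, integral_smul_nnreal_measure, hL.integral_map]
  have hbox : unitBox =ᵐ[volume] Set.Icc (0 : Fin 2 → ℝ) 1 := by
    have h : unitBox = Set.univ.pi fun _ => Set.Ioc (0 : ℝ) 1 := by
      ext x; simp [unitBox]
    rw [h]
    exact Measure.univ_pi_Ioc_ae_eq_Icc (f := fun _ : Fin 2 => (0 : ℝ)) (g := fun _ => 1)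
  rw [setIntegral_congr_set hbox]
  have hsum : ∀ u : Fin 2 → ℝ, ∑ i, ((w i : ℝ) • (fderiv ℝ q (latticeEquiv u)).comp
      (latticeEquiv : (Fin 2 → ℝ) →L[ℝ] Plane)) (Pi.single i 1) =
      fderiv ℝ q (latticeEquiv u) (latticeEquiv w) := fun u => by
    have hw : latticeEquiv w = ∑ i, w i • latticeEquiv (Pi.single i 1) := by
      rw [Fin.sum_univ_two]
      simp [latticeEquiv_apply]
    rw [hw, map_sum]
    refine Finset.sum_congr rfl fun i _ => ?_
    simp
  have hdiv := integral_divergence_of_hasFDerivAt_off_countable' (n := 1) (0 : Fin 2 → ℝ) 1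
    zero_le_one (fun i u => w i • q (latticeEquiv u))
    (fun i u => w i • (fderiv ℝ q (latticeEquiv u)).comp
      (latticeEquiv : (Fin 2 → ℝ) →L[ℝ] Plane)) ∅ Set.countable_empty
    (fun i => ((hq.continuous.comp latticeEquiv.continuous).const_smul (w i)).continuousOn)
    (fun u _ i => ((hd _).hasFDerivAt.comp u latticeEquiv.hasFDerivAt).const_smul (w i))
    (by
      simp only [hsum]
      exact ((hfd.comp latticeEquiv.continuous).clm_apply
        continuous_const).continuousOn.integrableOn_Icc)
  simp only [hsum] at hdiv
  have hres : ∫ u in Set.Icc (0 : Fin 2 → ℝ) 1,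
      fderiv ℝ q (latticeEquiv u) (latticeEquiv w) = 0 := by
    rw [hdiv]
    refine Finset.sum_eq_zero fun i _ => sub_eq_zero.2 ?_
    congr 1
    funext y
    exact congrArg _ (latticeEquiv_insertNth_one i y hper)
  rw [hres, smul_zero]

/-! ### The Hilbert space structure -/

lemma IsPeriodic.map₂ {α β γ : Type} {f : Plane → α} {g : Plane → β} (hf : IsPeriodic f)
    (hg : IsPeriodic g) (F : α → β → γ) : IsPeriodic fun x => F (f x) (g x) :=
  fun x => ⟨congrArg₂ F (hf x).1 (hg x).1, congrArg₂ F (hf x).2 (hg x).2⟩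

lemma IsPeriodic.map {α β : Type} {f : Plane → α} (hf : IsPeriodic f) (F : α → β) :
    IsPeriodic fun x => F (f x) :=
  fun x => ⟨congrArg F (hf x).1, congrArg F (hf x).2⟩

lemma MemL2.add {f g : Plane → ℂ} (hf : MemL2 f) (hg : MemL2 g) : MemL2 fun x => f x + g x :=
  ⟨hf.1.map₂ hg.1 (· + ·), hf.2.add hg.2⟩

lemma MemL2.sub {f g : Plane → ℂ} (hf : MemL2 f) (hg : MemL2 g) : MemL2 fun x => f x - g x :=
  ⟨hf.1.map₂ hg.1 (· - ·), hf.2.sub hg.2⟩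

lemma MemL2.const_mul {f : Plane → ℂ} (hf : MemL2 f) (c : ℂ) : MemL2 fun x => c * f x :=
  ⟨hf.1.map (c * ·), hf.2.const_mul c⟩

lemma MemL2.conj {f : Plane → ℂ} (hf : MemL2 f) : MemL2 fun x => conj (f x) :=
  ⟨hf.1.map _, hf.2.star⟩

lemma memL2_of_continuous {q : Plane → ℂ} (hq : Continuous q) (hper : IsPeriodic q) :
    MemL2 q := by
  refine ⟨hper, ?_⟩
  have hb : ∃ B, ∀ x ∈ cell, ‖q x‖ ≤ B := by
    obtain ⟨B, hB⟩ := (isCompact_Icc (a := (0 : Fin 2 → ℝ)) (b := 1)).exists_bound_of_continuousOn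
      (hq.comp latticeEquiv.continuous).continuousOn
    refine ⟨B, fun x hx => ?_⟩
    rw [cell_eq_image] at hx
    obtain ⟨u, hu, rfl⟩ := hx
    exact hB u ⟨fun i => (hu i trivial).1, fun i => (hu i trivial).2.le⟩
  obtain ⟨B, hB⟩ := hb
  exact MemLp.of_bound hq.aestronglyMeasurable B
    ((ae_restrict_iff' measurableSet_cell).2 (Eventually.of_forall hB))

lemma memL2_expo (k : Fin 2 → ℤ) : MemL2 (expo k) :=
  memL2_of_continuous (contDiff_expo k).continuous (isPeriodic_expo k)

lemma MemL2.integrable_conj_mul {f g : Plane → ℂ} (hf : MemL2 f) (hg : MemL2 g) :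
    Integrable (fun x => conj (f x) * g x) torus :=
  hf.conj.2.integrable_mul hg.2

lemma inner2_eq_inner_toLp {f g : Plane → ℂ} (hf : MemL2 f) (hg : MemL2 g) :
    inner2 f g = inner ℂ hf.2.toLp hg.2.toLp := by
  rw [L2.inner_def, inner2]
  refine integral_congr_ae ?_
  filter_upwards [hf.2.coeFn_toLp, hg.2.coeFn_toLp] with x h1 h2
  rw [h1, h2, RCLike.inner_apply, mul_comm]

lemma inner2_self (f : Plane → ℂ) : inner2 f f = (l2Norm f : ℂ) ^ 2 := by
  have h0 : 0 ≤ ∫ x, ‖f x‖ ^ 2 ∂torus := integral_nonneg fun x => by positivity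
  rw [l2Norm, ← Complex.ofReal_pow, Real.sq_sqrt h0, inner2, ← integral_complex_ofReal]
  congr 1
  funext x
  rw [mul_comm, Complex.mul_conj, Complex.normSq_eq_norm_sq]

lemma l2Norm_nonneg (f : Plane → ℂ) : 0 ≤ l2Norm f := Real.sqrt_nonneg _

lemma l2Norm_eq_norm_toLp {f : Plane → ℂ} (hf : MemL2 f) : l2Norm f = ‖hf.2.toLp‖ := by
  have h : (l2Norm f : ℂ) ^ 2 = (‖hf.2.toLp‖ : ℂ) ^ 2 := by
    rw [← inner2_self f, inner2_eq_inner_toLp hf hf, inner_self_eq_norm_sq_to_K]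
    rfl
  exact (pow_left_inj₀ (l2Norm_nonneg f) (norm_nonneg _) two_ne_zero).1 (by exact_mod_cast h)

lemma norm_inner2_le {f g : Plane → ℂ} (hf : MemL2 f) (hg : MemL2 g) :
    ‖inner2 f g‖ ≤ l2Norm f * l2Norm g := by
  rw [inner2_eq_inner_toLp hf hg, l2Norm_eq_norm_toLp hf, l2Norm_eq_norm_toLp hg]
  exact norm_inner_le_norm _ _

lemma l2Norm_add_le {f g : Plane → ℂ} (hf : MemL2 f) (hg : MemL2 g) :
    l2Norm (fun x => f x + g x) ≤ l2Norm f + l2Norm g := by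
  rw [l2Norm_eq_norm_toLp (hf.add hg), l2Norm_eq_norm_toLp hf, l2Norm_eq_norm_toLp hg]
  exact norm_add_le hf.2.toLp hg.2.toLp

lemma l2Norm_sub_le {f g : Plane → ℂ} (hf : MemL2 f) (hg : MemL2 g) :
    l2Norm (fun x => f x - g x) ≤ l2Norm f + l2Norm g := by
  rw [l2Norm_eq_norm_toLp (hf.sub hg), l2Norm_eq_norm_toLp hf, l2Norm_eq_norm_toLp hg]
  exact norm_sub_le hf.2.toLp hg.2.toLp

lemma l2Norm_const_mul (c : ℂ) (f : Plane → ℂ) :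
    l2Norm (fun x => c * f x) = ‖c‖ * l2Norm f := by
  simp only [l2Norm, norm_mul, mul_pow, integral_const_mul]
  rw [Real.sqrt_mul (by positivity), Real.sqrt_sq (norm_nonneg c)]

lemma l2Norm_congr_ae {f g : Plane → ℂ} (h : f =ᵐ[torus] g) : l2Norm f = l2Norm g := by
  rw [l2Norm, l2Norm]
  congr 1
  exact integral_congr_ae (by filter_upwards [h] with x hx; rw [hx])

lemma inner2_congr_right {f g g' : Plane → ℂ} (h : g =ᵐ[torus] g') :
    inner2 f g = inner2 f g' :=
  integral_congr_ae (by filter_upwards [h] with x hx; rw [hx])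

lemma inner2_add_right {f g h : Plane → ℂ} (hf : MemL2 f) (hg : MemL2 g) (hh : MemL2 h) :
    inner2 f (fun x => g x + h x) = inner2 f g + inner2 f h := by
  simp only [inner2, mul_add]
  exact integral_add (hf.integrable_conj_mul hg) (hf.integrable_conj_mul hh)

lemma inner2_sub_right {f g h : Plane → ℂ} (hf : MemL2 f) (hg : MemL2 g) (hh : MemL2 h) :
    inner2 f (fun x => g x - h x) = inner2 f g - inner2 f h := by
  simp only [inner2, mul_sub]
  exact integral_sub (hf.integrable_conj_mul hg) (hf.integrable_conj_mul hh)

lemma inner2_const_mul_right (c : ℂ) (f g : Plane → ℂ) :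
    inner2 f (fun x => c * g x) = c * inner2 f g := by
  simp only [inner2, ← integral_const_mul]
  congr 1; funext x; ring

lemma inner2_conj_symm (f g : Plane → ℂ) : conj (inner2 f g) = inner2 g f := by
  rw [inner2, ← integral_conj, inner2]
  congr 1; funext x
  simp [mul_comm]

lemma coef_add {f g : Plane → ℂ} (hf : MemL2 f) (hg : MemL2 g) (k : Fin 2 → ℤ) :
    coef (fun x => f x + g x) k = coef f k + coef g k := inner2_add_right (memL2_expo k) hf hg

lemma coef_sub {f g : Plane → ℂ} (hf : MemL2 f) (hg : MemL2 g) (k : Fin 2 → ℤ) :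
    coef (fun x => f x - g x) k = coef f k - coef g k := inner2_sub_right (memL2_expo k) hf hg

lemma coef_const_mul (c : ℂ) (f : Plane → ℂ) (k : Fin 2 → ℤ) :
    coef (fun x => c * f x) k = c * coef f k := inner2_const_mul_right c _ f

lemma hasSum_norm_coef_sq {f : Plane → ℂ} (hf : MemL2 f) :
    HasSum (fun k => ‖coef f k‖ ^ 2) (l2Norm f ^ 2) := by
  have h := hasSum_conj_coef_mul_coef hf hf
  rw [inner2_self f] at h
  have h2 : HasSum (fun k => ((‖coef f k‖ ^ 2 : ℝ) : ℂ)) ((l2Norm f ^ 2 : ℝ) : ℂ) := by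
    convert h using 1
    · funext k
      rw [Complex.conj_mul', Complex.ofReal_pow]
    · push_cast; rfl
  exact_mod_cast h2

lemma norm_coef_le {f : Plane → ℂ} (hf : MemL2 f) (k : Fin 2 → ℤ) : ‖coef f k‖ ≤ l2Norm f :=
  (pow_le_pow_iff_left₀ (norm_nonneg _) (l2Norm_nonneg f) two_ne_zero).1
    (le_hasSum (hasSum_norm_coef_sq hf) k fun _ _ => by positivity)

lemma ae_eq_zero_of_l2Norm_eq_zero {f : Plane → ℂ} (hf : MemL2 f) (h : l2Norm f = 0) :
    f =ᵐ[torus] 0 := by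
  rw [l2Norm_eq_norm_toLp hf, norm_eq_zero] at h
  have := hf.2.coeFn_toLp
  rw [h] at this
  exact this.symm.trans (Lp.coeFn_zero _ _ _)

lemma ae_eq_of_coef_eq {f g : Plane → ℂ} (hf : MemL2 f) (hg : MemL2 g)
    (h : ∀ k, coef f k = coef g k) : f =ᵐ[torus] g := by
  have h1 := hasSum_norm_coef_sq (hf.sub hg)
  simp only [coef_sub hf hg, h, sub_self, norm_zero, ne_eq, OfNat.ofNat_ne_zero,
    not_false_eq_true, zero_pow] at h1
  have h2 := pow_eq_zero_iff two_ne_zero |>.1 (h1.unique hasSum_zero)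
  filter_upwards [ae_eq_zero_of_l2Norm_eq_zero (hf.sub hg) h2] with x hx
  exact sub_eq_zero.1 hx

/-! ### Weak derivatives and Fourier coefficients -/

lemma IsPeriodic.fderiv {q : Plane → ℂ} (hq : IsPeriodic q) : IsPeriodic (fderiv ℝ q) := by
  refine fun x => ⟨?_, ?_⟩
  · rw [← fderiv_comp_add_right]
    congr 1; funext y; exact (hq y).1
  · rw [← fderiv_comp_add_right]
    congr 1; funext y; exact (hq y).2

/-- Integration by parts: the derivative of the product of `q` with the conjugate exponential has
integral zero. -/
lemma coef_fderiv {q : Plane → ℂ} (hq : ContDiff ℝ ∞ q) (hper : IsPeriodic q) (i : Fin 2)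
    (k : Fin 2 → ℤ) :
    coef (fun x => fderiv ℝ q x (EuclideanSpace.single i 1)) k =
      Complex.I * freq k i * coef q k := by
  have h := integral_fderiv_eq_zero (((contDiff_expo (-k)).mul hq))
    ((isPeriodic_expo (-k)).map₂ hper (· * ·)) (EuclideanSpace.single i 1)
  have hd : Differentiable ℝ q := hq.differentiable (by simp)
  have he : Differentiable ℝ (expo (-k)) := (contDiff_expo (-k)).differentiable (by simp)
  have hfd : Continuous fun x => fderiv ℝ q x (EuclideanSpace.single i 1) :=
    (hq.continuous_fderiv (by simp)).clm_apply continuous_const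
  have h1 : ∀ x, fderiv ℝ (fun y => expo (-k) y * q y) x (EuclideanSpace.single i 1) =
      conj (expo k x) * fderiv ℝ q x (EuclideanSpace.single i 1) -
        Complex.I * freq k i * (conj (expo k x) * q x) := fun x => by
    rw [fderiv_fun_mul (he x) (hd x)]
    simp only [add_apply, smul_apply, fderiv_expo,
      smul_eq_mul, conj_expo]
    have : (freq (-k) i : ℂ) = -freq k i := by
      fin_cases i <;> simp [freq] <;> ring
    rw [this]; ring
  have hq2 : MemL2 q := memL2_of_continuous hq.continuous hper
  have hfd2 : MemL2 fun x => fderiv ℝ q x (EuclideanSpace.single i 1) :=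
    memL2_of_continuous hfd (hper.fderiv.map fun A => A (EuclideanSpace.single i 1))
  simp only [h1] at h
  rw [integral_sub ((memL2_expo k).integrable_conj_mul hfd2)
    (((memL2_expo k).integrable_conj_mul hq2).const_mul _), integral_const_mul] at h
  exact sub_eq_zero.1 h

lemma HasWeakPartial.coef_eq {i : Fin 2} {f g : Plane → ℂ} (h : HasWeakPartial i f g)
    (k : Fin 2 → ℤ) : coef g k = Complex.I * freq k i * coef f k := by
  have h1 := h.2 (expo (-k)) (contDiff_expo _) (isPeriodic_expo _)
  have h2 : (freq (-k) i : ℂ) = -freq k i := by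
    fin_cases i <;> simp [freq] <;> ring
  simp only [fderiv_expo, h2] at h1
  simp only [coef, inner2, conj_expo, ← integral_const_mul]
  calc ∫ x, expo (-k) x * g x ∂torus = ∫ x, g x * expo (-k) x ∂torus := by simp only [mul_comm]
    _ = -∫ x, f x * (Complex.I * -freq k i * expo (-k) x) ∂torus := by rw [h1, neg_neg]
    _ = _ := by
      rw [← integral_neg]
      congr 1; funext x; ring

/-- Parseval on both sides of the weak identity: the multiplier iξ is purely imaginary, so moving it
across the inner product produces the minus sign. The test function is conjugated because `inner2`
is antilinear on the left. -/
lemma hasWeakPartial_of_coef_eq {i : Fin 2} {f g : Plane → ℂ} (hf : MemL2 f) (hg : MemL2 g)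
    (h : ∀ k, coef g k = Complex.I * freq k i * coef f k) : HasWeakPartial i f g := by
  refine ⟨hg, fun q hq hper => ?_⟩
  have hq' : ContDiff ℝ ∞ fun x => conj (q x) := Complex.conjCLE.contDiff.comp hq
  have hper' : IsPeriodic fun x => conj (q x) := hper.map _
  have hd : Differentiable ℝ q := hq.differentiable (by simp)
  have hfd : ∀ x, conj (fderiv ℝ q x (EuclideanSpace.single i 1)) =
      fderiv ℝ (fun x => conj (q x)) x (EuclideanSpace.single i 1) := fun x => by
    have : HasFDerivAt (fun x => conj (q x)) _ x :=
      (Complex.conjCLE.hasFDerivAt (x := q x)).comp x (hd x).hasFDerivAt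
    rw [this.fderiv]
    rfl
  have hD : MemL2 fun x => fderiv ℝ (fun x => conj (q x)) x (EuclideanSpace.single i 1) :=
    memL2_of_continuous ((hq'.continuous_fderiv (by simp)).clm_apply continuous_const)
      (hper'.fderiv.map fun A => A (EuclideanSpace.single i 1))
  have h1 := hasSum_conj_coef_mul_coef hD hf
  have h2 := hasSum_conj_coef_mul_coef (memL2_of_continuous hq'.continuous hper') hg
  simp only [coef_fderiv hq' hper', h] at h1 h2
  have h3 : inner2 (fun x => fderiv ℝ (fun x => conj (q x)) x (EuclideanSpace.single i 1)) f =
      -inner2 (fun x => conj (q x)) g := by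
    refine h1.unique ?_
    convert! h2.neg using 1
    funext k
    simp only [map_mul, Complex.conj_I, Complex.conj_ofReal]
    ring
  simp only [inner2, ← hfd, Complex.conj_conj] at h3
  simpa only [mul_comm] using h3

lemma HasWeakPartial.weakPartial {i : Fin 2} {f g : Plane → ℂ} (h : HasWeakPartial i f g) :
    HasWeakPartial i f (weakPartial i f) := by
  have h' : ∃ g, HasWeakPartial i f g := ⟨g, h⟩
  rw [HoneycombNLS.weakPartial, dif_pos h']
  exact h'.choose_spec

/-! ### The Sobolev space `H²` in terms of Fourier coefficients -/

/-- The weight `1 + |ξ_k|²`. -/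
def weight (k : Fin 2 → ℤ) : ℝ := 1 + (freq k 0 ^ 2 + freq k 1 ^ 2)

lemma one_le_weight (k : Fin 2 → ℤ) : 1 ≤ weight k := by
  have : 0 ≤ freq k 0 ^ 2 + freq k 1 ^ 2 := by positivity
  rw [weight]; linarith

lemma weight_pos (k : Fin 2 → ℤ) : 0 < weight k := zero_lt_one.trans_le (one_le_weight k)

lemma freq_sq_le_weight (k : Fin 2 → ℤ) (i : Fin 2) : freq k i ^ 2 ≤ weight k := by
  have h0 := sq_nonneg (freq k 0)
  have h1 := sq_nonneg (freq k 1)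
  fin_cases i <;> simp only [weight, Fin.zero_eta, Fin.mk_one] <;> linarith

lemma norm_sq_le_weight (k : Fin 2 → ℤ) : ‖k‖ ^ 2 ≤ weight k := by
  have hpi : 1 ≤ Real.pi ^ 2 := by nlinarith [Real.pi_gt_three]
  have h3 : Real.sqrt 3 ^ 2 = 3 := Real.sq_sqrt (by norm_num)
  have hw : weight k = 1 + 4 * Real.pi ^ 2 *
      (((k 0 : ℝ) + k 1) ^ 2 / 3 + ((k 0 : ℝ) - k 1) ^ 2) := by
    simp only [weight, freq, Matrix.cons_val_zero, Matrix.cons_val_one, mul_pow, div_pow, h3]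
    ring
  have hsum : (k 0 : ℝ) ^ 2 + (k 1 : ℝ) ^ 2 ≤ weight k := by
    rw [hw]
    have h : (k 0 : ℝ) ^ 2 + (k 1 : ℝ) ^ 2 ≤
        4 * (((k 0 : ℝ) + k 1) ^ 2 / 3 + ((k 0 : ℝ) - k 1) ^ 2) := by
      nlinarith [sq_nonneg ((k 0 : ℝ) - k 1), sq_nonneg ((k 0 : ℝ) + k 1)]
    have h' : 0 ≤ ((k 0 : ℝ) + k 1) ^ 2 / 3 + ((k 0 : ℝ) - k 1) ^ 2 := by positivity
    nlinarith
  obtain ⟨i, hi⟩ : ∃ i, ‖k‖ = ‖k i‖ := by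
    obtain ⟨i, -, hi⟩ := Finset.exists_mem_eq_sup' Finset.univ_nonempty fun i => ‖k i‖₊
    refine ⟨i, ?_⟩
    have : ‖k‖₊ = ‖k i‖₊ := by
      rw [← hi, Pi.nnnorm_def, Finset.sup'_eq_sup]
    exact congrArg NNReal.toReal this
  rw [hi, Int.norm_eq_abs, sq_abs]
  have h0 := sq_nonneg (k 0 : ℝ)
  have h1 := sq_nonneg (k 1 : ℝ)
  fin_cases i <;> simp only [Fin.zero_eta, Fin.mk_one] <;> linarith

lemma summable_inv_weight_sq : Summable fun k => (weight k)⁻¹ ^ 2 := by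
  have h := EisensteinSeries.summable_one_div_norm_rpow (k := 4) (by norm_num)
  -- The comparison series ‖k‖⁻⁴ takes the default value 0 at k = 0, so the term at the origin needs
  -- its own majorant.
  have h0 : Summable fun k : Fin 2 → ℤ => if k = 0 then (1 : ℝ) else 0 :=
    summable_of_hasFiniteSupport (by
      refine (Set.finite_singleton (0 : Fin 2 → ℤ)).subset fun k hk => ?_
      by_contra hne
      exact hk (if_neg hne))
  refine Summable.of_nonneg_of_le (fun k => by positivity) (fun k => ?_) (h.add h0)
  by_cases hk : k = 0
  · subst hk
    have : (weight 0)⁻¹ ≤ 1 := inv_le_one_of_one_le₀ (one_le_weight 0)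
    have h1 : (weight 0)⁻¹ ^ 2 ≤ 1 := pow_le_one₀ (inv_nonneg.2 (weight_pos 0).le) this
    have h2 : (0 : ℝ) ≤ ‖(0 : Fin 2 → ℤ)‖ ^ (-4 : ℝ) := by positivity
    simp only [if_true]
    linarith
  · have hpos : 0 < ‖k‖ := norm_pos_iff.2 hk
    rw [if_neg hk, add_zero, Real.rpow_neg hpos.le]
    have : ‖k‖ ^ (4 : ℝ) = (‖k‖ ^ 2) ^ 2 := by
      rw [← pow_mul]; exact_mod_cast Real.rpow_natCast ‖k‖ 4
    rw [this, inv_pow]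
    gcongr
    exact norm_sq_le_weight k

lemma MemH2.hasWeakPartial {f : Plane → ℂ} (hf : MemH2 f) (i : Fin 2) :
    HasWeakPartial i f (weakPartial i f) := (hf.first i).choose_spec.weakPartial

lemma MemH2.hasWeakPartial₂ {f : Plane → ℂ} (hf : MemH2 f) (i j : Fin 2) :
    HasWeakPartial j (weakPartial i f) (weakPartial j (weakPartial i f)) :=
  (hf.second i j).choose_spec.weakPartial

lemma MemH2.hasSum_h2Norm_sq {f : Plane → ℂ} (hf : MemH2 f) :
    HasSum (fun k => (1 + ∑ i, freq k i ^ 2 + ∑ i, ∑ j, (freq k j * freq k i) ^ 2) *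
      ‖coef f k‖ ^ 2) (h2Norm f ^ 2) := by
  have hn : 0 ≤ l2Norm f ^ 2 + ∑ i, l2Norm (weakPartial i f) ^ 2
      + ∑ i, ∑ j, l2Norm (weakPartial j (weakPartial i f)) ^ 2 := by positivity
  rw [h2Norm, Real.sq_sqrt hn]
  have h0 := hasSum_norm_coef_sq hf.memL2
  have h1 := hasSum_sum (s := Finset.univ) fun i _ =>
    hasSum_norm_coef_sq (hf.hasWeakPartial i).1
  have h2 := hasSum_sum (s := Finset.univ) fun i _ => hasSum_sum (s := Finset.univ) fun j _ =>
    hasSum_norm_coef_sq (hf.hasWeakPartial₂ i j).1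
  convert! (h0.add h1).add h2 using 1
  funext k
  simp only [(hf.hasWeakPartial₂ _ _).coef_eq, (hf.hasWeakPartial _).coef_eq, norm_mul,
    Complex.norm_I, Complex.norm_real, mul_pow, Real.norm_eq_abs, sq_abs, one_mul,
    add_mul, Finset.sum_mul]
  simp only [mul_assoc]

/-- With t = |ξ|² the double sum is t², and (1 + t)² ≤ 2(1 + t + t²). -/
lemma weight_sq_le (k : Fin 2 → ℤ) :
    weight k ^ 2 ≤ 2 * (1 + ∑ i, freq k i ^ 2 + ∑ i, ∑ j, (freq k j * freq k i) ^ 2) := by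
  simp only [weight, Fin.sum_univ_two]
  nlinarith [sq_nonneg (freq k 0 ^ 2 + freq k 1 ^ 2), sq_nonneg (freq k 0 * freq k 1)]

lemma MemH2.summable_weight {f : Plane → ℂ} (hf : MemH2 f) :
    Summable fun k => weight k ^ 2 * ‖coef f k‖ ^ 2 := by
  refine Summable.of_nonneg_of_le (fun k => by positivity) (fun k => ?_)
    (hf.hasSum_h2Norm_sq.summable.mul_left 2)
  rw [← mul_assoc]
  exact mul_le_mul_of_nonneg_right (weight_sq_le k) (by positivity)

/-- Riesz–Fischer supplies L² functions with the coefficients that the derivatives must have. This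
is how all membership in H² is proved below. -/
lemma memH2_of_summable_weight {f : Plane → ℂ} (hf : MemL2 f)
    (h : Summable fun k => weight k ^ 2 * ‖coef f k‖ ^ 2) : MemH2 f := by
  have h1 : ∀ i, ∃ g, HasWeakPartial i f g := fun i => by
    obtain ⟨g, hg, hgc⟩ := exists_memL2_coef_eq (a := fun k => Complex.I * freq k i * coef f k) (by
      refine Summable.of_nonneg_of_le (fun k => by positivity) (fun k => ?_) h
      simp only [norm_mul, Complex.norm_I, Complex.norm_real, mul_pow, Real.norm_eq_abs, sq_abs,
        one_mul]
      refine mul_le_mul_of_nonneg_right ?_ (by positivity)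
      nlinarith [freq_sq_le_weight k i, one_le_weight k])
    exact ⟨g, hasWeakPartial_of_coef_eq hf hg hgc⟩
  refine ⟨hf, h1, fun i j => ?_⟩
  have hi := (h1 i).choose_spec.weakPartial
  obtain ⟨g, hg, hgc⟩ := exists_memL2_coef_eq
    (a := fun k => Complex.I * freq k j * coef (weakPartial i f) k) (by
      refine Summable.of_nonneg_of_le (fun k => by positivity) (fun k => ?_) h
      simp only [hi.coef_eq, norm_mul, Complex.norm_I, Complex.norm_real, mul_pow,
        Real.norm_eq_abs, sq_abs, one_mul, mul_one, ← mul_assoc]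
      refine mul_le_mul_of_nonneg_right ?_ (by positivity)
      rw [sq (weight k)]
      exact mul_le_mul (freq_sq_le_weight k j) (freq_sq_le_weight k i) (by positivity)
        (weight_pos k).le)
  exact ⟨g, hasWeakPartial_of_coef_eq hi.1 hg hgc⟩

lemma MemH2.sub {f g : Plane → ℂ} (hf : MemH2 f) (hg : MemH2 g) :
    MemH2 fun x => f x - g x := by
  refine memH2_of_summable_weight (hf.memL2.sub hg.memL2) ?_
  refine Summable.of_nonneg_of_le (fun k => by positivity) (fun k => ?_)
    ((hf.summable_weight.add hg.summable_weight).mul_left 2)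
  rw [coef_sub hf.memL2 hg.memL2, ← mul_add, mul_left_comm]
  refine mul_le_mul_of_nonneg_left ?_ (by positivity)
  have := norm_sub_le (coef f k) (coef g k)
  nlinarith [norm_nonneg (coef f k - coef g k), sq_nonneg (‖coef f k‖ - ‖coef g k‖)]

lemma MemH2.const_mul {f : Plane → ℂ} (hf : MemH2 f) (c : ℂ) : MemH2 fun x => c * f x := by
  refine memH2_of_summable_weight (hf.memL2.const_mul c) ?_
  simp only [coef_const_mul, norm_mul, mul_pow, mul_left_comm _ (‖c‖ ^ 2)]
  exact hf.summable_weight.mul_left _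

lemma h2Norm_nonneg (f : Plane → ℂ) : 0 ≤ h2Norm f := Real.sqrt_nonneg _

lemma MemH2.h2Norm_const_mul {f : Plane → ℂ} (hf : MemH2 f) (c : ℂ) :
    h2Norm (fun x => c * f x) = ‖c‖ * h2Norm f := by
  have h1 := (hf.const_mul c).hasSum_h2Norm_sq
  have h2 := hf.hasSum_h2Norm_sq.mul_left (‖c‖ ^ 2)
  simp only [coef_const_mul, norm_mul, mul_pow (‖c‖), mul_left_comm _ (‖c‖ ^ 2)] at h1
  have h3 := h1.unique h2
  rw [← mul_pow] at h3
  exact (pow_left_inj₀ (h2Norm_nonneg _) (mul_nonneg (norm_nonneg _) (h2Norm_nonneg f))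
    two_ne_zero).1 h3

/-! ### The Sobolev embedding -/

/-- The Fourier series converges uniformly to a continuous function with the same coefficients,
hence equal to `f` almost everywhere. -/
lemma ae_norm_le_of_summable_coef {f : Plane → ℂ} (hf : MemL2 f)
    (h : Summable fun k => ‖coef f k‖) :
    ∀ᵐ x ∂torus, ‖f x‖ ≤ expoConst * ∑' k, ‖coef f k‖ := by
  have hnorm : ∀ k x, ‖coef f k * expo k x‖ = ‖coef f k‖ * expoConst := fun k x => by
    rw [norm_mul, norm_expo]
  set g : Plane → ℂ := fun x => ∑' k, coef f k * expo k x with hg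
  have hgc : Continuous g :=
    continuous_tsum (fun k => continuous_const.mul (contDiff_expo k).continuous)
      (h.mul_right expoConst) fun k x => (hnorm k x).le
  have hgp : IsPeriodic g := fun x =>
    ⟨tsum_congr fun k => by rw [(isPeriodic_expo k x).1],
      tsum_congr fun k => by rw [(isPeriodic_expo k x).2]⟩
  have hcoef : ∀ j, coef g j = coef f j := fun j => by
    have hi : ∀ k, Integrable (fun x => conj (expo j x) * (coef f k * expo k x)) torus := fun k =>
      (memL2_expo j).integrable_conj_mul ((memL2_expo k).const_mul _)
    have hs := hasSum_integral_of_summable_integral_norm hi (by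
      simp only [norm_mul, norm_expo, RCLike.norm_conj, integral_const, smul_eq_mul]
      exact (((h.mul_right expoConst).mul_left expoConst).mul_left _))
    have h1 : ∀ k, ∫ x, conj (expo j x) * (coef f k * expo k x) ∂torus =
        if k = j then coef f k else 0 := fun k => by
      have := coef_const_mul (coef f k) (expo k) j
      rw [coef_expo] at this
      refine this.trans ?_
      split_ifs <;> simp
    simp only [h1, tsum_mul_left] at hs
    rw [coef, inner2]
    refine hs.unique ?_
    have := hasSum_ite_eq j (coef f j)
    convert! this using 2 with k
    split_ifs with hk
    · rw [hk]
    · rfl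
  have hae := ae_eq_of_coef_eq hf (memL2_of_continuous hgc hgp) fun k => (hcoef k).symm
  filter_upwards [hae] with x hx
  rw [hx, mul_comm, ← tsum_mul_right]
  have hs : Summable fun k => ‖coef f k * expo k x‖ := by
    simp only [hnorm]; exact h.mul_right _
  refine (norm_tsum_le_tsum_norm hs).trans_eq ?_
  simp only [hnorm]

/-- The Sobolev embedding `H² ⊂ L^∞` in two dimensions. -/
theorem exists_sobolev_const : ∃ S : ℝ, 0 < S ∧ ∀ f, MemH2 f →
    ∀ᵐ x ∂torus, ‖f x‖ ≤ S * h2Norm f := by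
  set A : ℝ := ∑' k, (weight k)⁻¹ ^ 2 with hA
  have hA0 : 0 ≤ A := tsum_nonneg fun k => by positivity
  -- The summand 1 only serves to make the constant visibly positive.
  refine ⟨expoConst * Real.sqrt (2 * A) + 1, by
    have := expoConst_pos; positivity, fun f hf => ?_⟩
  have hbound : ∀ s : Finset (Fin 2 → ℤ),
      ∑ k ∈ s, ‖coef f k‖ ≤ Real.sqrt (2 * A) * h2Norm f := fun s => by
    -- Cauchy–Schwarz on finite sets, splitting off the weight; uniformity in the set gives both
    -- summability and the bound.
    have hcs := Finset.sum_mul_sq_le_sq_mul_sq s (fun k => (weight k)⁻¹)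
      fun k => weight k * ‖coef f k‖
    have h1 : ∑ k ∈ s, (weight k)⁻¹ ^ 2 ≤ A :=
      summable_inv_weight_sq.sum_le_tsum s fun k _ => by positivity
    have h2 : ∑ k ∈ s, (weight k * ‖coef f k‖) ^ 2 ≤ 2 * h2Norm f ^ 2 := by
      refine le_trans (Finset.sum_le_sum fun k _ => ?_)
        (sum_le_hasSum s (fun k _ => ?_) (hf.hasSum_h2Norm_sq.mul_left 2))
      · rw [mul_pow, ← mul_assoc]
        exact mul_le_mul_of_nonneg_right (weight_sq_le k) (by positivity)
      · positivity
    have h3 : ∀ k, (weight k)⁻¹ * (weight k * ‖coef f k‖) = ‖coef f k‖ := fun k =>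
      inv_mul_cancel_left₀ (weight_pos k).ne' _
    simp only [h3] at hcs
    have h4 : (∑ k ∈ s, ‖coef f k‖) ^ 2 ≤ (Real.sqrt (2 * A) * h2Norm f) ^ 2 := by
      rw [mul_pow, Real.sq_sqrt (by positivity)]
      calc _ ≤ _ := hcs
        _ ≤ A * (2 * h2Norm f ^ 2) :=
          mul_le_mul h1 h2 (Finset.sum_nonneg fun k _ => by positivity) hA0
        _ = _ := by ring
    exact (pow_le_pow_iff_left₀ (Finset.sum_nonneg fun k _ => norm_nonneg _)
      (mul_nonneg (Real.sqrt_nonneg _) (h2Norm_nonneg f)) two_ne_zero).1 h4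
  have hs : Summable fun k => ‖coef f k‖ := summable_of_sum_le (fun k => norm_nonneg _) hbound
  have ht : ∑' k, ‖coef f k‖ ≤ Real.sqrt (2 * A) * h2Norm f := hs.tsum_le_of_sum_le hbound
  filter_upwards [ae_norm_le_of_summable_coef hf.memL2 hs] with x hx
  calc ‖f x‖ ≤ _ := hx
    _ ≤ expoConst * (Real.sqrt (2 * A) * h2Norm f) :=
      mul_le_mul_of_nonneg_left ht expoConst_pos.le
    _ ≤ _ := by nlinarith [h2Norm_nonneg f]

/-! ### The linear Hamiltonian -/

/-- The symbol `|ξ_k + K|²` of `-(∇ + iK)²`. -/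
def symbol (k : Fin 2 → ℤ) : ℝ := ∑ j, (freq k j + momK j) ^ 2

lemma laplacianK_eq (f : Plane → ℂ) : laplacianK f = fun x =>
    (weakPartial 0 (weakPartial 0 f) x + 2 * Complex.I * (momK 0 : ℂ) * weakPartial 0 f x -
      (momK 0 : ℂ) ^ 2 * f x) +
    (weakPartial 1 (weakPartial 1 f) x + 2 * Complex.I * (momK 1 : ℂ) * weakPartial 1 f x -
      (momK 1 : ℂ) ^ 2 * f x) := by
  funext x; simp only [laplacianK, Fin.sum_univ_two]

lemma MemH2.memL2_laplacianK {f : Plane → ℂ} (hf : MemH2 f) : MemL2 (laplacianK f) := by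
  have h : ∀ j, MemL2 fun x => weakPartial j (weakPartial j f) x +
      2 * Complex.I * (momK j : ℂ) * weakPartial j f x - (momK j : ℂ) ^ 2 * f x := fun j =>
    ((hf.hasWeakPartial₂ j j).1.add ((hf.hasWeakPartial j).1.const_mul _)).sub
      (hf.memL2.const_mul _)
  rw [laplacianK_eq]
  exact (h 0).add (h 1)

lemma MemH2.coef_laplacianK {f : Plane → ℂ} (hf : MemH2 f) (k : Fin 2 → ℤ) :
    coef (laplacianK f) k = -symbol k * coef f k := by
  have hA : ∀ j, MemL2 fun x => weakPartial j (weakPartial j f) x +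
      2 * Complex.I * (momK j : ℂ) * weakPartial j f x := fun j =>
    (hf.hasWeakPartial₂ j j).1.add ((hf.hasWeakPartial j).1.const_mul _)
  have hB : ∀ j, MemL2 fun x => (momK j : ℂ) ^ 2 * f x := fun j => hf.memL2.const_mul _
  have h : ∀ j, coef (fun x => weakPartial j (weakPartial j f) x +
      2 * Complex.I * (momK j : ℂ) * weakPartial j f x - (momK j : ℂ) ^ 2 * f x) k =
      -((freq k j + momK j : ℝ) : ℂ) ^ 2 * coef f k := fun j => by
    rw [coef_sub (hA j) (hB j), coef_add (hf.hasWeakPartial₂ j j).1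
      ((hf.hasWeakPartial j).1.const_mul _), coef_const_mul, coef_const_mul,
      (hf.hasWeakPartial₂ j j).coef_eq, (hf.hasWeakPartial j).coef_eq]
    push_cast
    linear_combination (freq k j ^ 2 * coef f k + 2 * momK j * freq k j * coef f k : ℂ) *
      Complex.I_sq
  have h2 := coef_add ((hA 0).sub (hB 0)) ((hA 1).sub (hB 1)) k
  rw [h, h] at h2
  rw [laplacianK_eq, h2, symbol, Fin.sum_univ_two]
  push_cast
  ring

/-- The difference of the two sides is |ξ + 2K|². -/
lemma weight_le_symbol (k : Fin 2 → ℤ) :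
    weight k ≤ 2 * symbol k + (1 + 2 * (momK 0 ^ 2 + momK 1 ^ 2)) := by
  simp only [weight, symbol, Fin.sum_univ_two]
  nlinarith [sq_nonneg (freq k 0 + 2 * momK 0), sq_nonneg (freq k 1 + 2 * momK 1)]

lemma MemL2.potential_mul {W : Plane → ℝ} (hW : Continuous W) (hper : IsPeriodic W)
    {f : Plane → ℂ} (hf : MemL2 f) : MemL2 fun x => (W x : ℂ) * f x := by
  refine ⟨hper.map₂ hf.1 fun a b => (a : ℂ) * b, ?_⟩
  have hb : ∃ B, ∀ x ∈ cell, ‖(W x : ℂ)‖ ≤ B := by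
    obtain ⟨B, hB⟩ := (isCompact_Icc (a := (0 : Fin 2 → ℝ)) (b := 1)).exists_bound_of_continuousOn
      (hW.comp latticeEquiv.continuous).continuousOn
    refine ⟨B, fun x hx => ?_⟩
    rw [cell_eq_image] at hx
    obtain ⟨u, hu, rfl⟩ := hx
    rw [Complex.norm_real]
    exact hB u ⟨fun i => (hu i trivial).1, fun i => (hu i trivial).2.le⟩
  obtain ⟨B, hB⟩ := hb
  have hWinf : MemLp (fun x => (W x : ℂ)) ⊤ torus :=
    memLp_top_of_bound (Complex.continuous_ofReal.comp hW).aestronglyMeasurable B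
      ((ae_restrict_iff' measurableSet_cell).2 (Eventually.of_forall hB))
  exact hf.2.mul hWinf

lemma MemH2.memL2_hamiltonian {W : Plane → ℝ} (hW : Continuous W) (hper : IsPeriodic W)
    {f : Plane → ℂ} (hf : MemH2 f) : MemL2 (hamiltonian W f) := by
  have h := (hf.memL2_laplacianK.const_mul (-1)).add (hf.memL2.potential_mul hW hper)
  simp only [neg_one_mul] at h
  exact h

lemma MemH2.coef_hamiltonian {W : Plane → ℝ} (hW : Continuous W) (hper : IsPeriodic W)
    {f : Plane → ℂ} (hf : MemH2 f) (k : Fin 2 → ℤ) :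
    coef (hamiltonian W f) k = symbol k * coef f k + coef (fun x => (W x : ℂ) * f x) k := by
  have h := coef_add (hf.memL2_laplacianK.const_mul (-1)) (hf.memL2.potential_mul hW hper) k
  rw [coef_const_mul, hf.coef_laplacianK] at h
  simp only [neg_one_mul] at h
  refine Eq.trans h ?_
  ring

lemma inner2_potential_mul (W : Plane → ℝ) (f g : Plane → ℂ) :
    inner2 f (fun x => (W x : ℂ) * g x) = inner2 (fun x => (W x : ℂ) * f x) g := by
  simp only [inner2, map_mul, Complex.conj_ofReal]
  congr 1; funext x; ring

/-- The linear Hamiltonian is symmetric. -/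
theorem inner2_hamiltonian_symm {W : Plane → ℝ} (hW : Continuous W) (hper : IsPeriodic W)
    {f g : Plane → ℂ} (hf : MemH2 f) (hg : MemH2 g) :
    inner2 f (hamiltonian W g) = inner2 (hamiltonian W f) g := by
  have hWf := hf.memL2.potential_mul hW hper
  have hWg := hg.memL2.potential_mul hW hper
  have h1 := hasSum_conj_coef_mul_coef hf.memL2 (hg.memL2_hamiltonian hW hper)
  have h2 := hasSum_conj_coef_mul_coef (hf.memL2_hamiltonian hW hper) hg.memL2
  have h3 := hasSum_conj_coef_mul_coef hf.memL2 hWg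
  have h4 := hasSum_conj_coef_mul_coef hWf hg.memL2
  rw [← inner2_potential_mul] at h4
  have h5 := h1.sub h3
  have h6 := h2.sub h4
  have h7 : (fun k => conj (coef f k) * coef (hamiltonian W g) k -
      conj (coef f k) * coef (fun x => (W x : ℂ) * g x) k) = fun k =>
      conj (coef (hamiltonian W f) k) * coef g k -
      conj (coef (fun x => (W x : ℂ) * f x) k) * coef g k := by
    funext k
    rw [hf.coef_hamiltonian hW hper, hg.coef_hamiltonian hW hper]
    simp only [map_add, map_mul, Complex.conj_ofReal]
    ring
  rw [h7] at h5
  exact sub_left_inj.1 (h5.unique h6)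

/-! ### The gap estimate -/

lemma l2Norm_potential_mul_expo (W : Plane → ℝ) (k : Fin 2 → ℤ) :
    l2Norm (fun x => (W x : ℂ) * expo k x) = l2Norm (fun x => (W x : ℂ) * expo 0 x) := by
  simp only [l2Norm, norm_mul, norm_expo]

/-- Elliptic decay of the Fourier coefficients. -/
lemma MemH2.weight_mul_norm_coef_le {W : Plane → ℝ} (hW : Continuous W) (hper : IsPeriodic W)
    {f : Plane → ℂ} (hf : MemH2 f) (k : Fin 2 → ℤ) :
    weight k * ‖coef f k‖ ≤ 2 * l2Norm (hamiltonian W f) +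
      (2 * l2Norm (fun x => (W x : ℂ) * expo 0 x) +
        (1 + 2 * (momK 0 ^ 2 + momK 1 ^ 2))) * l2Norm f := by
  have h1 := hf.coef_hamiltonian hW hper k
  have hs : 0 ≤ symbol k := Finset.sum_nonneg fun j _ => sq_nonneg _
  have h2 : symbol k * ‖coef f k‖ ≤ l2Norm (hamiltonian W f) +
      l2Norm (fun x => (W x : ℂ) * expo 0 x) * l2Norm f := by
    have e : ((symbol k : ℂ)) * coef f k =
        coef (hamiltonian W f) k - coef (fun x => (W x : ℂ) * f x) k := by rw [h1]; ring
    calc symbol k * ‖coef f k‖ = ‖(symbol k : ℂ) * coef f k‖ := by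
          rw [norm_mul, Complex.norm_real, Real.norm_of_nonneg hs]
      _ ≤ ‖coef (hamiltonian W f) k‖ + ‖coef (fun x => (W x : ℂ) * f x) k‖ := by
          rw [e]; exact norm_sub_le _ _
      _ ≤ _ := by
          refine add_le_add (norm_coef_le (hf.memL2_hamiltonian hW hper) k) ?_
          -- Moving the potential onto the exponential, whose modulus is constant, gives a bound
          -- independent of `k`.
          rw [coef, inner2_potential_mul, ← l2Norm_potential_mul_expo W k]
          exact norm_inner2_le ((memL2_expo k).potential_mul hW hper) hf.memL2
  have h3 := mul_le_mul_of_nonneg_right (weight_le_symbol k) (norm_nonneg (coef f k))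
  have h4 := mul_le_mul_of_nonneg_left (norm_coef_le hf.memL2 k)
    (show 0 ≤ 1 + 2 * (momK 0 ^ 2 + momK 1 ^ 2) by positivity)
  linarith

lemma summable_mul_of_summable_sq {ι : Type} {a b : ι → ℝ} (ha0 : ∀ k, 0 ≤ a k)
    (hb0 : ∀ k, 0 ≤ b k) (ha : Summable fun k => a k ^ 2) (hb : Summable fun k => b k ^ 2) :
    Summable fun k => a k * b k :=
  Summable.of_nonneg_of_le (fun k => mul_nonneg (ha0 k) (hb0 k))
    (fun k => by nlinarith [sq_nonneg (a k - b k), sq_nonneg (a k), sq_nonneg (b k)])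
    (ha.add hb)

/-- Compactness of `H²` in `L²`, in the weak form in which only the decay of the Fourier
coefficients is used. -/
lemma exists_subseq_limit {ψ : ℕ → Plane → ℂ} (hψ : ∀ n, MemL2 (ψ n)) {R : ℝ}
    (hR : ∀ n k, weight k * ‖coef (ψ n) k‖ ≤ R) :
    ∃ (y : Plane → ℂ) (s : ℕ → ℕ), MemL2 y ∧ StrictMono s ∧
      (∀ g, MemL2 g → Tendsto (fun n => inner2 g (ψ (s n))) atTop (𝓝 (inner2 g y))) ∧
      Tendsto (fun n => l2Norm (ψ (s n)) ^ 2) atTop (𝓝 (l2Norm y ^ 2)) := by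
  have hball : ∀ n k, ‖coef (ψ n) k‖ ≤ R * (weight k)⁻¹ := fun n k => by
    rw [← div_eq_mul_inv, le_div_iff₀ (weight_pos k), mul_comm]
    exact hR n k
  -- Tychonoff on the product of discs of radius R / weight extracts one subsequence along which
  -- every coefficient converges. Square summability of the radii then permits dominated convergence
  -- in Parseval's sums.
  obtain ⟨a, ha, s, hs, hlim⟩ :=
    (isCompact_univ_pi fun k : Fin 2 → ℤ =>
      isCompact_closedBall (0 : ℂ) (R * (weight k)⁻¹)).tendsto_subseq
      (x := fun n k => coef (ψ n) k) fun n k _ => by simpa using hball n k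
  have hak : ∀ k, ‖a k‖ ≤ R * (weight k)⁻¹ := fun k => by simpa using ha k trivial
  have hlimk : ∀ k, Tendsto (fun n => coef (ψ (s n)) k) atTop (𝓝 (a k)) :=
    fun k => (tendsto_pi_nhds.1 hlim) k
  have hRsum : Summable fun k => (R * (weight k)⁻¹) ^ 2 := by
    simp only [mul_pow]; exact summable_inv_weight_sq.mul_left _
  have hR0 : ∀ k, 0 ≤ R * (weight k)⁻¹ := fun k => (norm_nonneg _).trans (hak k)
  have hasum : Summable fun k => ‖a k‖ ^ 2 :=
    Summable.of_nonneg_of_le (fun k => by positivity)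
      (fun k => pow_le_pow_left₀ (norm_nonneg _) (hak k) 2) hRsum
  obtain ⟨y, hy, hyc⟩ := exists_memL2_coef_eq hasum
  refine ⟨y, s, hy, hs, fun g hg => ?_, ?_⟩
  · rw [← (hasSum_conj_coef_mul_coef hg hy).tsum_eq]
    simp only [← (hasSum_conj_coef_mul_coef hg (hψ _)).tsum_eq, hyc]
    refine tendsto_tsum_of_dominated_convergence
      (bound := fun k => ‖coef g k‖ * (R * (weight k)⁻¹))
      (summable_mul_of_summable_sq (fun k => norm_nonneg _) hR0
        (hasSum_norm_coef_sq hg).summable hRsum)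
      (fun k => (hlimk k).const_mul _) (Eventually.of_forall fun n k => ?_)
    rw [norm_mul, RCLike.norm_conj]
    exact mul_le_mul_of_nonneg_left (hball _ k) (norm_nonneg _)
  · rw [← (hasSum_norm_coef_sq hy).tsum_eq]
    simp only [← (hasSum_norm_coef_sq (hψ _)).tsum_eq, hyc]
    refine tendsto_tsum_of_dominated_convergence hRsum
      (fun k => ((hlimk k).norm).pow 2) (Eventually.of_forall fun n k => ?_)
    rw [Real.norm_of_nonneg (by positivity)]
    exact pow_le_pow_left₀ (norm_nonneg _) (hball _ k) 2

/-- An `L²` function which satisfies the linear equation in the weak sense is in `H²`. -/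
lemma memH2_of_weak_solution {W : Plane → ℝ} (hW : Continuous W) (hper : IsPeriodic W)
    {y : Plane → ℂ} (hy : MemL2 y)
    (h : ∀ k, symbol k * coef y k + coef (fun x => (W x : ℂ) * y x) k = 0) : MemH2 y := by
  refine memH2_of_summable_weight hy ?_
  set c : ℝ := 1 + 2 * (momK 0 ^ 2 + momK 1 ^ 2) with hc
  have hc0 : 0 ≤ c := by positivity
  have hWy := hy.potential_mul hW hper
  -- The constants come from (2A + cB)² ≤ 8A² + 2c²B².
  have hsum := ((hasSum_norm_coef_sq hWy).summable.mul_left 8).add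
    ((hasSum_norm_coef_sq hy).summable.mul_left (2 * c ^ 2))
  refine Summable.of_nonneg_of_le (fun k => by positivity) (fun k => ?_) hsum
  have hs : 0 ≤ symbol k := Finset.sum_nonneg fun j _ => sq_nonneg _
  have h1 : symbol k * ‖coef y k‖ = ‖coef (fun x => (W x : ℂ) * y x) k‖ := by
    rw [← norm_neg (coef (fun x => (W x : ℂ) * y x) k), ← eq_neg_of_add_eq_zero_left (h k),
      norm_mul, Complex.norm_real, Real.norm_of_nonneg hs]
  have h2 := mul_le_mul_of_nonneg_right (weight_le_symbol k) (norm_nonneg (coef y k))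
  have h3 : weight k * ‖coef y k‖ ≤
      2 * ‖coef (fun x => (W x : ℂ) * y x) k‖ + c * ‖coef y k‖ := by
    rw [← h1]; linarith
  have h4 : (weight k * ‖coef y k‖) ^ 2 ≤
      (2 * ‖coef (fun x => (W x : ℂ) * y x) k‖ + c * ‖coef y k‖) ^ 2 :=
    pow_le_pow_left₀ (mul_nonneg (weight_pos k).le (norm_nonneg _)) h3 2
  nlinarith [sq_nonneg (2 * ‖coef (fun x => (W x : ℂ) * y x) k‖ - c * ‖coef y k‖)]

lemma hamiltonian_sub_const (W : Plane → ℝ) (E : ℝ) (f : Plane → ℂ) (x : Plane) :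
    hamiltonian (fun x => W x - E) f x = hamiltonian W f x - E * f x := by
  simp only [hamiltonian]; push_cast; ring

/-- `weakPartial` chooses a representative, so linearity is available only almost everywhere; it is
read off from the Fourier coefficients. -/
lemma laplacianK_const_mul_ae {f : Plane → ℂ} (hf : MemH2 f) (c : ℂ) :
    laplacianK (fun x => c * f x) =ᵐ[torus] fun x => c * laplacianK f x :=
  ae_eq_of_coef_eq (hf.const_mul c).memL2_laplacianK (hf.memL2_laplacianK.const_mul c) fun k => by
    rw [(hf.const_mul c).coef_laplacianK, coef_const_mul, coef_const_mul, hf.coef_laplacianK]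
    ring

lemma laplacianK_sub_ae {f g : Plane → ℂ} (hf : MemH2 f) (hg : MemH2 g) :
    laplacianK (fun x => f x - g x) =ᵐ[torus] fun x => laplacianK f x - laplacianK g x :=
  ae_eq_of_coef_eq (hf.sub hg).memL2_laplacianK (hf.memL2_laplacianK.sub hg.memL2_laplacianK)
    fun k => by
      rw [(hf.sub hg).coef_laplacianK, coef_sub hf.memL2 hg.memL2,
        coef_sub hf.memL2_laplacianK hg.memL2_laplacianK, hf.coef_laplacianK, hg.coef_laplacianK]
      ring

lemma hamiltonian_const_mul_ae (W : Plane → ℝ) {f : Plane → ℂ} (hf : MemH2 f) (c : ℂ) :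
    hamiltonian W (fun x => c * f x) =ᵐ[torus] fun x => c * hamiltonian W f x := by
  filter_upwards [laplacianK_const_mul_ae hf c] with x hx
  simp only [hamiltonian, hx]; ring

lemma hamiltonian_sub_ae (W : Plane → ℝ) {f g : Plane → ℂ} (hf : MemH2 f) (hg : MemH2 g) :
    hamiltonian W (fun x => f x - g x) =ᵐ[torus]
      fun x => hamiltonian W f x - hamiltonian W g x := by
  filter_upwards [laplacianK_sub_ae hf hg] with x hx
  simp only [hamiltonian, hx]; ring

/-- If the kernel of `-(∇ + iK)² + W` lies in the span of `φa`, `φb`, then the operator is bounded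
below up to the components along `φa` and `φb`. -/
theorem exists_gap_const {W : Plane → ℝ} (hW : Continuous W) (hper : IsPeriodic W)
    {φa φb : Plane → ℂ} (ha : MemL2 φa) (hb : MemL2 φb)
    (hspan : ∀ f, MemH2 f → hamiltonian W f =ᵐ[torus] 0 →
      ∃ α β : ℂ, f =ᵐ[torus] fun x => α * φa x + β * φb x) :
    ∃ G : ℝ, 0 < G ∧ ∀ f, MemH2 f →
      l2Norm f ≤ G * (l2Norm (hamiltonian W f) + ‖inner2 φa f‖ + ‖inner2 φb f‖) := by
  by_contra! hcon
  -- Failure of every constant gives normalized functions with vanishing residual and vanishing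
  -- ground components. Their limit will be a unit kernel element orthogonal to the span that
  -- contains it.
  have hseq : ∀ n : ℕ, ∃ f, MemH2 f ∧ l2Norm f = 1 ∧
      l2Norm (hamiltonian W f) + ‖inner2 φa f‖ + ‖inner2 φb f‖ ≤ 1 / ((n : ℝ) + 1) := fun n => by
    obtain ⟨f, hf, hlt⟩ := hcon ((n : ℝ) + 1) (by positivity)
    have hpos : 0 < l2Norm f := lt_of_le_of_lt (mul_nonneg (by positivity)
      (add_nonneg (add_nonneg (l2Norm_nonneg _) (norm_nonneg _)) (norm_nonneg _))) hlt
    refine ⟨fun x => ((l2Norm f)⁻¹ : ℝ) * f x, hf.const_mul _, ?_, ?_⟩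
    · rw [l2Norm_const_mul, Complex.norm_real, Real.norm_of_nonneg (inv_nonneg.2 hpos.le),
        inv_mul_cancel₀ hpos.ne']
    · rw [l2Norm_congr_ae (hamiltonian_const_mul_ae W hf _), l2Norm_const_mul,
        inner2_const_mul_right, inner2_const_mul_right, norm_mul, norm_mul, Complex.norm_real,
        Real.norm_of_nonneg (inv_nonneg.2 hpos.le), ← mul_add, ← mul_add, inv_mul_le_iff₀ hpos,
        mul_one_div, le_div_iff₀ (by positivity), mul_comm]
      exact hlt.le
  choose ψ hψ hψ1 hψ2 using hseq
  have hsmall : ∀ n, l2Norm (hamiltonian W (ψ n)) ≤ 1 / ((n : ℝ) + 1) ∧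
      ‖inner2 φa (ψ n)‖ ≤ 1 / ((n : ℝ) + 1) ∧ ‖inner2 φb (ψ n)‖ ≤ 1 / ((n : ℝ) + 1) := fun n => by
    have h0 := hψ2 n
    have h1 := l2Norm_nonneg (hamiltonian W (ψ n))
    have h2 := norm_nonneg (inner2 φa (ψ n))
    have h3 := norm_nonneg (inner2 φb (ψ n))
    refine ⟨?_, ?_, ?_⟩ <;> linarith
  have hone : ∀ n : ℕ, 1 / ((n : ℝ) + 1) ≤ 1 := fun n =>
    (div_le_one (by positivity)).2 (by linarith [n.cast_nonneg (α := ℝ)])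
  obtain ⟨y, s, hy, hs, hweak, hnorm⟩ := exists_subseq_limit (fun n => (hψ n).memL2)
    (R := 2 * 1 + (2 * l2Norm (fun x => (W x : ℂ) * expo 0 x) +
        (1 + 2 * (momK 0 ^ 2 + momK 1 ^ 2))) * 1) fun n k => by
      have := (hψ n).weight_mul_norm_coef_le hW hper k
      rw [hψ1 n] at this
      linarith [(hsmall n).1, hone n]
  have hy1 : l2Norm y ^ 2 = 1 := by
    simp only [hψ1, one_pow] at hnorm
    exact tendsto_nhds_unique hnorm tendsto_const_nhds
  have hzero : Tendsto (fun n => 1 / (((s n : ℕ) : ℝ) + 1)) atTop (𝓝 0) :=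
    tendsto_one_div_add_atTop_nhds_zero_nat.comp hs.tendsto_atTop
  have hya : inner2 φa y = 0 := tendsto_nhds_unique (hweak φa ha)
    (squeeze_zero_norm (fun n => (hsmall (s n)).2.1) hzero)
  have hyb : inner2 φb y = 0 := tendsto_nhds_unique (hweak φb hb)
    (squeeze_zero_norm (fun n => (hsmall (s n)).2.2) hzero)
  -- The limit is so far only in L², so the equation is passed to it coefficientwise; regularity
  -- then puts it in H².
  have heq : ∀ k, symbol k * coef y k + coef (fun x => (W x : ℂ) * y x) k = 0 := fun k => by
    have h1 : Tendsto (fun n => coef (hamiltonian W (ψ (s n))) k) atTop (𝓝 0) :=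
      squeeze_zero_norm (fun n => (norm_coef_le ((hψ _).memL2_hamiltonian hW hper) k).trans
        (hsmall (s n)).1) hzero
    have h2 := ((hweak _ (memL2_expo k)).const_mul (symbol k : ℂ)).add
      (hweak _ ((memL2_expo k).potential_mul hW hper))
    simp only [← inner2_potential_mul] at h2
    refine tendsto_nhds_unique (h2.congr fun n => ?_) h1
    exact ((hψ (s n)).coef_hamiltonian hW hper k).symm
  have hyH := memH2_of_weak_solution hW hper hy heq
  have hz : MemL2 (0 : Plane → ℂ) := memL2_of_continuous continuous_const fun x => ⟨rfl, rfl⟩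
  obtain ⟨α, β, hαβ⟩ := hspan y hyH <| ae_eq_of_coef_eq (hyH.memL2_hamiltonian hW hper) hz
    fun k => by
      rw [hyH.coef_hamiltonian hW hper, heq]
      simp [coef, inner2]
  have h0 : inner2 y y = 0 := by
    rw [inner2_congr_right hαβ, inner2_add_right hy (ha.const_mul α) (hb.const_mul β),
      inner2_const_mul_right, inner2_const_mul_right, ← inner2_conj_symm φa, hya,
      ← inner2_conj_symm φb, hyb]
    simp
  rw [inner2_self, ← Complex.ofReal_pow, hy1] at h0
  simp at h0

/-! ### The nonlinearity -/

/-- Mean value inequality on the compact convex set (closed cell) × [0,1]. Derivatives are taken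
within s ≥ 0, as smoothness is only assumed there. -/
lemma exists_lipschitz_const {v : Plane → ℝ → ℝ}
    (hv : ContDiffOn ℝ ∞ (Function.uncurry v) (Set.univ ×ˢ Set.Ici (0 : ℝ))) :
    ∃ L : ℝ, 0 < L ∧ ∀ x ∈ cell, ∀ s ∈ Set.Icc (0 : ℝ) 1, ∀ t ∈ Set.Icc (0 : ℝ) 1,
      |v x s - v x t| ≤ L * |s - t| := by
  set Ω : Set (Plane × ℝ) := Set.univ ×ˢ Set.Ici (0 : ℝ) with hΩ
  set P : Set Plane := latticeEquiv '' Set.Icc (0 : Fin 2 → ℝ) 1 with hP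
  set D : Set (Plane × ℝ) := P ×ˢ Set.Icc (0 : ℝ) 1 with hD
  have hDΩ : D ⊆ Ω := Set.prod_mono (Set.subset_univ _) Set.Icc_subset_Ici_self
  have hDc : IsCompact D := (isCompact_Icc.image latticeEquiv.continuous).prod isCompact_Icc
  have hDconv : Convex ℝ D :=
    ((convex_Icc _ _).linear_image (latticeEquiv : (Fin 2 → ℝ) →ₗ[ℝ] Plane)).prod (convex_Icc _ _)
  have hu : UniqueDiffOn ℝ Ω := uniqueDiffOn_univ.prod (uniqueDiffOn_Ici 0)
  obtain ⟨B, hB⟩ := hDc.exists_bound_of_continuousOn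
    ((hv.continuousOn_fderivWithin hu (by simp)).mono hDΩ)
  have hcell : cell ⊆ P := by
    rw [cell_eq_image]
    exact Set.image_mono fun u hu =>
      ⟨fun i => (hu i trivial).1, fun i => (hu i trivial).2.le⟩
  refine ⟨|B| + 1, by positivity, fun x hx s hs t ht => ?_⟩
  have h := hDconv.norm_image_sub_le_of_norm_hasFDerivWithin_le
    (f := Function.uncurry v) (f' := fderivWithin ℝ (Function.uncurry v) Ω) (C := B)
    (fun p hp => ((hv.differentiableOn (by simp)) p (hDΩ hp)).hasFDerivWithinAt.mono hDΩ) hB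
    (show (x, t) ∈ D from ⟨hcell hx, ht⟩) (show (x, s) ∈ D from ⟨hcell hx, hs⟩)
  simp only [Function.uncurry_apply_pair, Real.norm_eq_abs, Prod.mk_sub_mk, sub_self,
    Prod.norm_mk, norm_zero] at h
  rw [max_eq_right (abs_nonneg _)] at h
  exact h.trans (mul_le_mul_of_nonneg_right (by linarith [le_abs_self B]) (abs_nonneg _))

/-- Local Lipschitz estimate for the cubic-type nonlinearity `z ↦ v(|z|²) z`. -/
lemma norm_nonlinearity_sub_le {v : ℝ → ℝ} {L m : ℝ} (hL : 0 < L) (hm : m ≤ 1) (h0 : v 0 = 0)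
    (hv : ∀ s ∈ Set.Icc (0 : ℝ) 1, ∀ t ∈ Set.Icc (0 : ℝ) 1, |v s - v t| ≤ L * |s - t|)
    {z w : ℂ} (hz : ‖z‖ ≤ m) (hw : ‖w‖ ≤ m) :
    ‖(v (‖z‖ ^ 2) : ℂ) * z - (v (‖w‖ ^ 2) : ℂ) * w‖ ≤ 3 * L * m ^ 2 * ‖z - w‖ := by
  have hm0 : 0 ≤ m := (norm_nonneg z).trans hz
  have hIcc : ∀ u : ℂ, ‖u‖ ≤ m → ‖u‖ ^ 2 ∈ Set.Icc (0 : ℝ) 1 := fun u hu =>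
    ⟨by positivity, pow_le_one₀ (norm_nonneg u) (hu.trans hm)⟩
  have h1 : |v (‖z‖ ^ 2)| ≤ L * m ^ 2 := by
    have := hv _ (hIcc z hz) 0 ⟨le_rfl, zero_le_one⟩
    rw [h0, sub_zero, sub_zero, abs_of_nonneg (sq_nonneg ‖z‖)] at this
    exact this.trans (mul_le_mul_of_nonneg_left (pow_le_pow_left₀ (norm_nonneg z) hz 2) hL.le)
  have h2 : |v (‖z‖ ^ 2) - v (‖w‖ ^ 2)| ≤ L * (2 * m * ‖z - w‖) := by
    refine (hv _ (hIcc z hz) _ (hIcc w hw)).trans (mul_le_mul_of_nonneg_left ?_ hL.le)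
    have : ‖z‖ ^ 2 - ‖w‖ ^ 2 = (‖z‖ + ‖w‖) * (‖z‖ - ‖w‖) := by ring
    rw [this, abs_mul, abs_of_nonneg (by positivity)]
    exact mul_le_mul (by linarith) (abs_norm_sub_norm_le z w) (abs_nonneg _) (by positivity)
  -- The first summand contributes 1 and the second 2 to the constant 3.
  have e : (v (‖z‖ ^ 2) : ℂ) * z - (v (‖w‖ ^ 2) : ℂ) * w =
      (v (‖z‖ ^ 2) : ℂ) * (z - w) + ((v (‖z‖ ^ 2) - v (‖w‖ ^ 2) : ℝ) : ℂ) * w := by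
    push_cast; ring
  rw [e]
  calc _ ≤ |v (‖z‖ ^ 2)| * ‖z - w‖ + |v (‖z‖ ^ 2) - v (‖w‖ ^ 2)| * ‖w‖ := by
        refine (norm_add_le _ _).trans_eq ?_
        rw [norm_mul, norm_mul, Complex.norm_real, Complex.norm_real, Real.norm_eq_abs,
          Real.norm_eq_abs]
    _ ≤ L * m ^ 2 * ‖z - w‖ + L * (2 * m * ‖z - w‖) * m := by
        gcongr
    _ = _ := by ring

lemma l2Norm_le_of_ae_le {f g : Plane → ℂ} (hf : MemL2 f) (hg : MemL2 g) {c : ℝ} (hc : 0 ≤ c)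
    (h : ∀ᵐ x ∂torus, ‖f x‖ ≤ c * ‖g x‖) : l2Norm f ≤ c * l2Norm g := by
  rw [l2Norm_eq_norm_toLp hf, l2Norm_eq_norm_toLp hg, Lp.norm_toLp, Lp.norm_toLp]
  have := eLpNorm_le_mul_eLpNorm_of_ae_le_mul h 2
  refine (ENNReal.toReal_mono (ENNReal.mul_ne_top ENNReal.ofReal_ne_top hg.2.2.ne) this).trans_eq ?_
  rw [ENNReal.toReal_mul, ENNReal.toReal_ofReal hc]

/-! ### Small eigenfunctions -/

section SmallEigenfunctions

variable {VL : Plane → ℝ} {v : Plane → ℝ → ℝ} {E₀ : ℝ} {φa φb : Plane → ℂ} {C ε η : ℝ} {p : Param}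

/-- Phase covariance of the nonlinear eigenvalue problem. -/
lemma IsSmallEigenfunction.const_mul {f : Plane → ℂ} {E u : ℂ} (hu : ‖u‖ = 1)
    (h : IsSmallEigenfunction VL v E₀ φa φb C ε η p f E) {p' : Param}
    (h1 : p'.1.1 = u * p.1.1) (h2 : p'.1.2 = u * p.1.2) :
    IsSmallEigenfunction VL v E₀ φa φb C ε η p' (fun x => u * f x) E where
  memH2 := h.memH2.const_mul u
  eigen := by
    filter_upwards [h.eigen, laplacianK_const_mul_ae h.memH2 u] with x hx hl
    simp only [nonlinearHamiltonian, hamiltonian, norm_mul, hu, one_mul, hl] at hx ⊢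
    linear_combination u * hx
  proj_a := by rw [inner2_const_mul_right, h.proj_a, h1]; ring
  proj_b := by rw [inner2_const_mul_right, h.proj_b, h2]; ring
  l2_small := by rw [l2Norm_const_mul, hu, one_mul]; exact h.l2_small
  h2_small := by rw [h.memH2.h2Norm_const_mul, hu, one_mul]; exact h.h2_small
  near := h.near

lemma Param.exists_phase {p q : Param} (h : p ≈ q) :
    ∃ u : ℂ, ‖u‖ = 1 ∧ q.1.1 = u * p.1.1 ∧ q.1.2 = u * p.1.2 := by
  have hrel : p.1.1 * q.1.2 - p.1.2 * q.1.1 = 0 := h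
  have hp : conj p.1.1 * p.1.1 + conj p.1.2 * p.1.2 = 1 := by
    rw [Complex.conj_mul', Complex.conj_mul']
    exact_mod_cast p.2
  -- The phase is the Hermitian product of two parallel unit vectors.
  set u : ℂ := conj p.1.1 * q.1.1 + conj p.1.2 * q.1.2 with hu
  have h1 : q.1.1 = u * p.1.1 := by
    rw [hu]; linear_combination -conj p.1.2 * hrel - q.1.1 * hp
  have h2 : q.1.2 = u * p.1.2 := by
    rw [hu]; linear_combination conj p.1.1 * hrel - q.1.2 * hp
  refine ⟨u, ?_, h1, h2⟩
  have hq := q.2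
  rw [h1, h2, norm_mul, norm_mul, mul_pow, mul_pow, ← mul_add, p.2, mul_one] at hq
  exact (pow_eq_one_iff_of_nonneg (norm_nonneg u) two_ne_zero).1 hq

/-- Each representative of an allowed class has a small eigenfunction. -/
lemma exists_isSmallEigenfunction_of_mem_allowed
    (h : (Quotient.mk paramSetoid p : ParamQ) ∈ allowed VL v E₀ φa φb C ε η) :
    ∃ f E, IsSmallEigenfunction VL v E₀ φa φb C ε η p f E := by
  obtain ⟨q, hq, f, E, hf⟩ := h
  obtain ⟨u, hu, h1, h2⟩ := Param.exists_phase (Quotient.exact hq)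
  exact ⟨_, E, hf.const_mul hu h1 h2⟩

/-- The nonlinear term of the eigenvalue equation, as an element of `L²`. -/
def nonlinearTerm (VL : Plane → ℝ) (E : ℂ) (f : Plane → ℂ) (x : Plane) : ℂ :=
  E * f x - hamiltonian VL f x

lemma IsSmallEigenfunction.memL2_nonlinearTerm (hVc : Continuous VL) (hVp : IsPeriodic VL)
    {f : Plane → ℂ} {E : ℂ} (h : IsSmallEigenfunction VL v E₀ φa φb C ε η p f E) :
    MemL2 (nonlinearTerm VL E f) :=
  (h.memH2.memL2.const_mul E).sub (h.memH2.memL2_hamiltonian hVc hVp)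

/-- Defining the term through the linear operator makes membership in L² immediate; this identity
restores the pointwise formula needed for the Lipschitz estimates. -/
lemma IsSmallEigenfunction.nonlinearTerm_ae {f : Plane → ℂ} {E : ℂ}
    (h : IsSmallEigenfunction VL v E₀ φa φb C ε η p f E) :
    ∀ᵐ x ∂torus, nonlinearTerm VL E f x = (v x (‖f x‖ ^ 2) : ℂ) * f x := by
  filter_upwards [h.eigen] with x hx
  simp only [nonlinearHamiltonian, hamiltonian] at hx
  simp only [nonlinearTerm, hamiltonian, ← hx]
  push_cast; ring

/-- The linear part of the eigenvalue equation applied to the difference of two solutions. -/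
lemma IsSmallEigenfunction.hamiltonian_sub_ae {f f' : Plane → ℂ} {E E' : ℂ} {p' : Param}
    (h : IsSmallEigenfunction VL v E₀ φa φb C ε η p f E)
    (h' : IsSmallEigenfunction VL v E₀ φa φb C ε η p' f' E') :
    hamiltonian (fun x => VL x - E₀) (fun x => f x - f' x) =ᵐ[torus] fun x =>
      ((E - E₀) * (f x - f' x) + (E - E') * f' x) -
        (nonlinearTerm VL E f x - nonlinearTerm VL E' f' x) := by
  filter_upwards [HoneycombNLS.hamiltonian_sub_ae (fun x => VL x - E₀) h.memH2 h'.memH2] with x hx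
  rw [hx, hamiltonian_sub_const, hamiltonian_sub_const, nonlinearTerm, nonlinearTerm]
  ring

end SmallEigenfunctions

/-- Lipschitz estimate for the nonlinear term between two small eigenfunctions. -/
lemma l2Norm_nonlinearTerm_sub_le {VL : Plane → ℝ} {v : Plane → ℝ → ℝ} {E₀ : ℝ}
    {φa φb : Plane → ℂ} {C ε η L S : ℝ} {p : Param} (hVc : Continuous VL) (hVp : IsPeriodic VL)
    (hL : 0 < L) (hS : 0 < S) (hv0 : ∀ x, v x 0 = 0)
    (hv : ∀ x ∈ cell, ∀ s ∈ Set.Icc (0 : ℝ) 1, ∀ t ∈ Set.Icc (0 : ℝ) 1,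
      |v x s - v x t| ≤ L * |s - t|)
    (hsob : ∀ f, MemH2 f → ∀ᵐ x ∂torus, ‖f x‖ ≤ S * h2Norm f) (hε : S * (C * ε) ≤ 1)
    {f f' : Plane → ℂ} {E E' : ℂ}
    (h : IsSmallEigenfunction VL v E₀ φa φb C ε η p f E)
    (h' : IsSmallEigenfunction VL v E₀ φa φb C ε η p f' E') :
    l2Norm (nonlinearTerm VL E f) ≤ 3 * L * (S * (C * ε)) ^ 2 * l2Norm f ∧
    l2Norm (fun x => nonlinearTerm VL E f x - nonlinearTerm VL E' f' x) ≤
      3 * L * (S * (C * ε)) ^ 2 * l2Norm (fun x => f x - f' x) := by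
  have hmem : ∀ᵐ x ∂torus, x ∈ cell := ae_restrict_mem measurableSet_cell
  have hb : ∀ {g : Plane → ℂ} {E : ℂ}, IsSmallEigenfunction VL v E₀ φa φb C ε η p g E →
      ∀ᵐ x ∂torus, ‖g x‖ ≤ S * (C * ε) := fun {g E} hg => by
    filter_upwards [hsob g hg.memH2] with x hx
    exact hx.trans (mul_le_mul_of_nonneg_left hg.h2_small hS.le)
  have hm0 : 0 ≤ S * (C * ε) :=
    mul_nonneg hS.le ((h2Norm_nonneg f).trans h.h2_small)
  constructor
  · refine l2Norm_le_of_ae_le (h.memL2_nonlinearTerm hVc hVp) h.memH2.memL2 (by positivity) ?_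
    filter_upwards [hmem, hb h, h.nonlinearTerm_ae] with x hx h1 h2
    have := norm_nonlinearity_sub_le hL hε (hv0 x) (hv x hx) h1 (w := 0) (by simpa using hm0)
    rw [h2]
    simpa using this
  · refine l2Norm_le_of_ae_le ((h.memL2_nonlinearTerm hVc hVp).sub
      (h'.memL2_nonlinearTerm hVc hVp)) (h.memH2.memL2.sub h'.memH2.memL2) (by positivity) ?_
    filter_upwards [hmem, hb h, hb h', h.nonlinearTerm_ae, h'.nonlinearTerm_ae]
      with x hx h1 h1' h2 h2'
    rw [h2, h2']
    exact norm_nonlinearity_sub_le hL hε (hv0 x) (hv x hx) h1 h1'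

/-! ### Eigenvalue shift and absorption -/

/-- Testing the equation with a normalized function in the kernel of the linear Hamiltonian bounds
the eigenvalue shift `d`. -/
lemma norm_shift_mul_le {W : Plane → ℝ} (hW : Continuous W) (hper : IsPeriodic W)
    {φ ψ f N : Plane → ℂ} {c d : ℂ} (hφ : MemH2 φ) (hφ0 : hamiltonian W φ =ᵐ[torus] 0)
    (hφ1 : l2Norm φ = 1) (hψ : MemH2 ψ) (hf : MemL2 f) (hN : MemL2 N)
    (hort : inner2 φ ψ = 0)
    (heq : hamiltonian W ψ =ᵐ[torus] fun x => (c * ψ x + d * f x) - N x) :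
    ‖d‖ * ‖inner2 φ f‖ ≤ l2Norm N := by
  have h1 : inner2 φ (hamiltonian W ψ) = 0 := by
    rw [inner2_hamiltonian_symm hW hper hφ hψ, inner2]
    refine (integral_congr_ae ?_).trans (integral_zero _ _)
    filter_upwards [hφ0] with x hx
    simp [hx]
  rw [inner2_congr_right heq, inner2_sub_right hφ.memL2
    ((hψ.memL2.const_mul c).add (hf.const_mul d)) hN, inner2_add_right hφ.memL2
    (hψ.memL2.const_mul c) (hf.const_mul d), inner2_const_mul_right, inner2_const_mul_right,
    hort, mul_zero, zero_add] at h1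
  rw [← norm_mul, sub_eq_zero.1 h1]
  have := norm_inner2_le hφ.memL2 hN
  rwa [hφ1, one_mul] at this

/-- Two small eigenfunctions with the same component in the linear ground space agree. -/
theorem IsSmallEigenfunction.unique {VL : Plane → ℝ} {v : Plane → ℝ → ℝ} {E₀ : ℝ}
    {φa φb : Plane → ℂ} {C ε η B G : ℝ} {p : Param} (hVc : Continuous VL) (hVp : IsPeriodic VL)
    (hground : IsGroundPair VL E₀ φa φb) (hB : 0 ≤ B) (hG : 0 < G) (hε : 0 < ε) (hε1 : ε ≤ 1)
    (hη : 0 < η) (hsmall : G * (1 + 8 * G * B + B) * ε ≤ 1 / 2)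
    (hgap : ∀ f, MemH2 f → l2Norm f ≤
      G * (l2Norm (hamiltonian (fun x => VL x - E₀) f) + ‖inner2 φa f‖ + ‖inner2 φb f‖))
    {f f' : Plane → ℂ} {E E' : ℂ}
    (h : IsSmallEigenfunction VL v E₀ φa φb C ε η p f E)
    (h' : IsSmallEigenfunction VL v E₀ φa φb C ε η p f' E')
    (hn' : l2Norm (nonlinearTerm VL E' f') ≤ B * ε ^ 2 * l2Norm f')
    (hn : l2Norm (fun x => nonlinearTerm VL E f x - nonlinearTerm VL E' f' x) ≤
      B * ε ^ 2 * l2Norm (fun x => f x - f' x)) :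
    f =ᵐ[torus] f' ∧ E = E' := by
  set W : Plane → ℝ := fun x => VL x - E₀ with hWdef
  have hW : Continuous W := hVc.sub continuous_const
  have hWp : IsPeriodic W := hVp.map (· - E₀)
  have hker : ∀ {g : Plane → ℂ}, SolvesLinear VL E₀ g → hamiltonian W g =ᵐ[torus] 0 :=
    fun {g} hg => by
      filter_upwards [hg.2] with x hx
      rw [hamiltonian_sub_const, hx, sub_self]; rfl
  have hNL := (h.memL2_nonlinearTerm hVc hVp).sub (h'.memL2_nonlinearTerm hVc hVp)
  have hN'L := h'.memL2_nonlinearTerm hVc hVp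
  have hψ := h.memH2.sub h'.memH2
  have hort : inner2 φa (fun x => f x - f' x) = 0 ∧ inner2 φb (fun x => f x - f' x) = 0 := by
    rw [inner2_sub_right hground.solves_a.1.memL2 h.memH2.memL2 h'.memH2.memL2,
      inner2_sub_right hground.solves_b.1.memL2 h.memH2.memL2 h'.memH2.memL2,
      h.proj_a, h'.proj_a, h.proj_b, h'.proj_b]
    simp
  have hna := norm_nonneg p.1.1
  have hnb := norm_nonneg p.1.2
  have hpn := p.2
  set ψ : ℝ := l2Norm (fun x => f x - f' x) with hψdef
  set δ : ℝ := l2Norm (fun x => nonlinearTerm VL E f x - nonlinearTerm VL E' f' x) with hδ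
  set F : ℝ := l2Norm f' with hF
  have hψ0 : 0 ≤ ψ := l2Norm_nonneg _
  have hF0 : 0 ≤ F := l2Norm_nonneg _
  have hδ0 : 0 ≤ δ := l2Norm_nonneg _
  have hε2 : B * ε ^ 2 ≤ B * ε := mul_le_mul_of_nonneg_left (by nlinarith) hB
  -- The eigenvalue shift is controlled by the nonlinear terms.
  have hshift : ‖E - E'‖ * η ≤ 2 * δ := by
    have ha := norm_shift_mul_le hW hWp hground.solves_a.1 (hker hground.solves_a) hground.norm_a
      hψ h'.memH2.memL2 hNL hort.1 (h.hamiltonian_sub_ae h')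
    have hb := norm_shift_mul_le hW hWp hground.solves_b.1 (hker hground.solves_b) hground.norm_b
      hψ h'.memH2.memL2 hNL hort.2 (h.hamiltonian_sub_ae h')
    rw [h'.proj_a, norm_mul, Complex.norm_real, Real.norm_of_nonneg hη.le] at ha
    rw [h'.proj_b, norm_mul, Complex.norm_real, Real.norm_of_nonneg hη.le] at hb
    -- Adding both tests avoids deciding which of the two components is large.
    have hab : 1 ≤ ‖p.1.1‖ + ‖p.1.2‖ := by nlinarith
    have := mul_le_mul_of_nonneg_left hab (mul_nonneg (norm_nonneg (E - E')) hη.le)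
    linarith
  -- The amplitude controls the whole solution.
  have hFη : F ≤ 4 * G * η := by
    have h1 := hgap f' h'.memH2
    have h2 : hamiltonian W f' =ᵐ[torus] fun x => (E' - E₀) * f' x - nonlinearTerm VL E' f' x :=
      Eventually.of_forall fun x => by
        simp only [hWdef, hamiltonian_sub_const, nonlinearTerm]; ring
    have h3 : l2Norm (hamiltonian W f') ≤ ε * F + B * ε ^ 2 * F := by
      rw [l2Norm_congr_ae h2]
      refine (l2Norm_sub_le (h'.memH2.memL2.const_mul _) hN'L).trans (add_le_add ?_ hn')
      rw [l2Norm_const_mul]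
      exact mul_le_mul_of_nonneg_right h'.near hF0
    rw [h'.proj_a, h'.proj_b, norm_mul, norm_mul, Complex.norm_real,
      Real.norm_of_nonneg hη.le] at h1
    have ha1 : η * ‖p.1.1‖ ≤ η * 1 := mul_le_mul_of_nonneg_left (by nlinarith) hη.le
    have hb1 : η * ‖p.1.2‖ ≤ η * 1 := mul_le_mul_of_nonneg_left (by nlinarith) hη.le
    have h4 : F ≤ G * (ε * F + B * ε * F + 2 * η) := by
      refine h1.trans (mul_le_mul_of_nonneg_left ?_ hG.le)
      have := mul_le_mul_of_nonneg_right hε2 hF0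
      linarith
    -- Half of F is absorbed on the left, leaving F ≤ 2 · 2Gη.
    have h5 : G * (ε * F + B * ε * F) ≤ 1 / 2 * F := by
      refine le_trans (le_of_eq ?_) (mul_le_mul_of_nonneg_right (show G * (1 + B) * ε ≤ 1 / 2 from
        le_trans ?_ hsmall) hF0)
      · ring
      · have : 0 ≤ G * (8 * G * B) * ε := by positivity
        linarith
    linarith
  have hψz : ψ = 0 := by
    have h1 := hgap _ hψ
    rw [hort.1, hort.2, norm_zero, add_zero, add_zero,
      l2Norm_congr_ae (h.hamiltonian_sub_ae h')] at h1
    have h2 : l2Norm (fun x => ((E - E₀) * (f x - f' x) + (E - E') * f' x) -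
        (nonlinearTerm VL E f x - nonlinearTerm VL E' f' x)) ≤ ε * ψ + ‖E - E'‖ * F + δ := by
      refine (l2Norm_sub_le ((hψ.memL2.const_mul _).add (h'.memH2.memL2.const_mul _)) hNL).trans
        (add_le_add ((l2Norm_add_le (hψ.memL2.const_mul _)
          (h'.memH2.memL2.const_mul _)).trans (add_le_add ?_ ?_)) le_rfl)
      · rw [l2Norm_const_mul]
        exact mul_le_mul_of_nonneg_right h.near hψ0
      · rw [l2Norm_const_mul]
    -- Here η cancels: F ≤ 4Gη and the shift times η is at most 2δ.
    have h3 : ‖E - E'‖ * F ≤ 8 * G * δ := by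
      have h4 := mul_le_mul_of_nonneg_left hFη (norm_nonneg (E - E'))
      have h5 := mul_le_mul_of_nonneg_left hshift (show 0 ≤ 4 * G by positivity)
      linarith
    have h6 : δ ≤ B * ε * ψ := hn.trans (mul_le_mul_of_nonneg_right hε2 hψ0)
    have h7 : ψ ≤ G * (1 + 8 * G * B + B) * ε * ψ := by
      calc ψ ≤ G * (ε * ψ + (8 * G + 1) * δ) :=
            h1.trans (mul_le_mul_of_nonneg_left (by linarith) hG.le)
        _ ≤ G * (ε * ψ + (8 * G + 1) * (B * ε * ψ)) := by gcongr
        _ = _ := by ring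
    have h8 := mul_le_mul_of_nonneg_right hsmall hψ0
    linarith
  have hδz : δ = 0 := by
    rw [hψz, mul_zero] at hn
    exact le_antisymm hn hδ0
  refine ⟨?_, ?_⟩
  · filter_upwards [ae_eq_zero_of_l2Norm_eq_zero hψ.memL2 hψz] with x hx
    exact sub_eq_zero.1 hx
  · rw [hδz, mul_zero] at hshift
    have : ‖E - E'‖ = 0 := le_antisymm
      (le_of_mul_le_mul_right (by linarith) hη) (norm_nonneg _)
    exact sub_eq_zero.1 (norm_eq_zero.1 this)

end HoneycombNLS

end

/-! ### The uniqueness theorem -/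

theorem mainTheorem4
    (VL K : HoneycombNLS.Plane → ℝ) (v : HoneycombNLS.Plane → ℝ → ℝ)
    (hVL_smooth : ContDiff ℝ ∞ VL) (hVL : HoneycombNLS.IsHoneycomb VL)
    (hv_smooth : ContDiffOn ℝ ∞ (Function.uncurry v) (Set.univ ×ˢ Set.Ici (0 : ℝ)))
    (hv_per : ∀ s : ℝ, 0 ≤ s → HoneycombNLS.IsPeriodic (fun x => v x s))
    (hK : HoneycombNLS.IsHoneycomb K) (hK_ne : K ≠ 0)
    (hvK : ∀ x, (fun s : ℝ => v x s - K x * s) =O[𝓝[≥] (0 : ℝ)] (fun s : ℝ => s ^ 2))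
    (E₀ : ℝ) (φa φb : HoneycombNLS.Plane → ℂ)
    (hground : HoneycombNLS.IsGroundPair VL E₀ φa φb)
    (hnondeg : ∫ x, K x * (‖φa x‖ ^ 4 - 2 * ‖φb x‖ ^ 2 * ‖φa x‖ ^ 2) ∂HoneycombNLS.torus ≠ 0)
    (C : ℝ) (hC : 0 < C) :
    ∃ ε₀ : ℝ, 0 < ε₀ ∧ ∀ ε : ℝ, 0 < ε → ε < ε₀ → ∀ η : ℝ, 0 < η → ∀ p : HoneycombNLS.Param,
      (Quotient.mk HoneycombNLS.paramSetoid p : HoneycombNLS.ParamQ) ∈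
        HoneycombNLS.allowed VL v E₀ φa φb C ε η →
      ∃ (φ : HoneycombNLS.Plane → ℂ) (E : ℂ),
        HoneycombNLS.IsSmallEigenfunction VL v E₀ φa φb C ε η p φ E ∧
        ∀ (φ' : HoneycombNLS.Plane → ℂ) (E' : ℂ),
          HoneycombNLS.IsSmallEigenfunction VL v E₀ φa φb C ε η p φ' E' →
            φ' =ᵐ[HoneycombNLS.torus] φ ∧ E' = E := by
  -- The filter `𝓝[≥] 0` contains information at s = 0 itself, where the bound c · 0² forces v(x,0)
  -- = 0.
  have hv0 : ∀ x, v x 0 = 0 := fun x => by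
    obtain ⟨c, hc⟩ := (hvK x).bound
    have := hc.self_of_nhdsWithin (Set.mem_Ici.2 le_rfl)
    simpa using this
  have hVc : Continuous VL := hVL_smooth.continuous
  obtain ⟨L, hL, hLip⟩ := HoneycombNLS.exists_lipschitz_const hv_smooth
  obtain ⟨S, hS, hsob⟩ := HoneycombNLS.exists_sobolev_const
  obtain ⟨G, hG, hgap⟩ := HoneycombNLS.exists_gap_const (W := fun x => VL x - E₀)
    (hVc.sub continuous_const) (hVL.periodic.map (· - E₀)) hground.solves_a.1.memL2
    hground.solves_b.1.memL2 fun f hf h0 => hground.spans f ⟨hf, by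
      filter_upwards [h0] with x hx
      rw [HoneycombNLS.hamiltonian_sub_const] at hx
      exact sub_eq_zero.1 hx⟩
  set B : ℝ := 3 * L * (S * C) ^ 2 with hB
  have hB0 : 0 < B := by positivity
  -- The three thresholds give ε² ≤ ε, pointwise values at most 1 so that the Lipschitz bound on
  -- [0,1] applies, and an absorption factor at most 1/2.
  refine ⟨min 1 (min (1 / (S * C)) (1 / (2 * (G * (1 + 8 * G * B + B))))), by positivity,
    fun ε hε hlt η hη p hp => ?_⟩
  obtain ⟨hε1, hlt'⟩ := lt_min_iff.1 hlt
  obtain ⟨hε2, hε3⟩ := lt_min_iff.1 hlt'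
  rw [lt_div_iff₀ (by positivity)] at hε2 hε3
  obtain ⟨f, E, hf⟩ := HoneycombNLS.exists_isSmallEigenfunction_of_mem_allowed hp
  refine ⟨f, E, hf, fun f' E' hf' => ?_⟩
  have hSC : S * (C * ε) ≤ 1 := by linarith
  have hBe : 3 * L * (S * (C * ε)) ^ 2 = B * ε ^ 2 := by rw [hB]; ring
  -- Both orders are needed: this one for the difference, the other for the bound on the nonlinear
  -- term of `f` alone.
  have h1 := HoneycombNLS.l2Norm_nonlinearTerm_sub_le hVc hVL.periodic hL hS hv0 hLip hsob hSC hf' hf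
  have h2 := HoneycombNLS.l2Norm_nonlinearTerm_sub_le hVc hVL.periodic hL hS hv0 hLip hsob hSC hf hf'
  rw [hBe] at h1 h2
  exact HoneycombNLS.IsSmallEigenfunction.unique hVc hVL.periodic hground hB0.le hG hε hε1.le hη
    (by linarith) hgap hf' hf h2.1 h1.2
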